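/- A \emph{matroid-constrained matching instance} $(G,\succ,\mathcal I)$ consists of a finite bipartite graph $G=(A\cup O,E)$ with agents $A$ and objects $O$, a matroid $\mathcal I$ on $O$, and for every $a\in A$ a preference relation $\succ_a$ on the set $O_a$ of objects adjacent to $a$. Preferences are \emph{weak rankings} if every $\succ_a$ is irreflexive, asymmetric and transitive, and the relation "neither $x\succ_a y$ nor $y\succ_a x$" is transitive on $O_a$. An $\mathcal I$-\emph{constrained matching} is a matching $M\subseteq E$ whose set of matched objects is independent in $\mathcal I$. Write $M\succ_a N$ if $a$ is matched in $M$ and either $a$ is unmatched in $N$ or $M(a)\succ_a N(a)$. A set $\mathcal M$ of $\mathcal I$-constrained matchings is - \emph{popular} (weakly Condorcet-winning) if for every $\mathcal I$-constrained matching $N$ $$|\{a\in A:\exists M\in\mathcal M,\ M\succ_a N\}|\ \ge\ |\{a\in A:\forall M\in\mathcal M,\ N\succ_a M\}|;$$ - \emph{Pareto-optimal} if there is no set $\mathcal Y$ of $\mathcal I$-constrained matchings with $|\mathcal Y|\le|\mathcal M|$ such that for every agent $a$ there is $Y\in\mathcal Y$ with $M\not\succ_a Y$ for all $M\in\mathcal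 M$, and for some agent $a$ there is $Y\in\mathcal Y$ with $Y\succ_a M$ for all $M\in\mathcal M$. \textbf{Theorem.} Under weak-ranking preferences, every matroid-constrained matching instance has a popular set $\{M_1,M_2\}$ of at most two $\mathcal I$-constrained matchings ($M_1=M_2$ is allowed) that is also Pareto-optimal. Moreover, such a set can be computed in polynomial time when $\mathcal I$ is given by an independence oracle: there are one algorithm and one polynomial $p$ such that, for every instance with $n$ agents, $m$ objects and weak-ranking preferences, the algorithm, given the adjacency matrix of $G$, the comparisons $o\succ_a o'$ for $o,o'\in O_a$, and an oracle telling whether a subset of $O$ is independent, halts after at most $p(n+m)$ steps and outputs $M_1,M_2$ such that $\{M_1,M_2\}$ is Pareto-optimal and popular. (An algorithm is a while-program on a random access machine over natural numbers with unit-cost addition and truncated subtraction and without multiplication; an oracle call counts as one step.) -/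

import Mathlib

namespace PopularSets

/-! ## Elections: popular sets and Pareto-optimal sets

An election consists of a set `X` of alternatives and, for every agent `a`, a relation `pref a`,
where `pref a Y Z` says that agent `a` strictly prefers `Y` to `Z`. -/

section Election

variable {A 𝒜 : Type*}

/-- The number `φ(𝒴, Z)` of agents who prefer some member of `𝒴` to `Z`. -/
noncomputable def phiSet (pref : A → 𝒜 → 𝒜 → Prop) (𝒴 : Set 𝒜) (Z : 𝒜) : ℕ :=
  {a : A | ∃ Y ∈ 𝒴, pref a Y Z}.ncard

/-- The number `φ(Z, 𝒴)` of agents who prefer `Z` to every member of `𝒴`. -/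
noncomputable def phiAlt (pref : A → 𝒜 → 𝒜 → Prop) (Z : 𝒜) (𝒴 : Set 𝒜) : ℕ :=
  {a : A | ∀ Y ∈ 𝒴, pref a Z Y}.ncard

/-- The margin `μ(𝒴, Z) = φ(𝒴, Z) - φ(Z, 𝒴)`. -/
noncomputable def margin (pref : A → 𝒜 → 𝒜 → Prop) (𝒴 : Set 𝒜) (Z : 𝒜) : ℤ :=
  (phiSet pref 𝒴 Z : ℤ) - (phiAlt pref Z 𝒴 : ℤ)

/-- `𝒴` is a popular (that is, weakly Condorcet-winning) set of alternatives. -/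
def IsPopular (X : Set 𝒜) (pref : A → 𝒜 → 𝒜 → Prop) (𝒴 : Set 𝒜) : Prop :=
  𝒴 ⊆ X ∧ ∀ Z ∈ X, 0 ≤ margin pref 𝒴 Z

/-- `𝒴` Pareto-dominates `𝒵`. -/
def ParetoDominates (pref : A → 𝒜 → 𝒜 → Prop) (𝒴 𝒵 : Set 𝒜) : Prop :=
  𝒴.ncard ≤ 𝒵.ncard ∧
  (∀ a, ∃ Y ∈ 𝒴, ∀ Z ∈ 𝒵, ¬ pref a Z Y) ∧
  (∃ a, ∃ Y ∈ 𝒴, ∀ Z ∈ 𝒵, pref a Y Z)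

/-- `𝒵` is a Pareto-optimal set of alternatives. -/
def IsParetoOptimal (X : Set 𝒜) (pref : A → 𝒜 → 𝒜 → Prop) (𝒵 : Set 𝒜) : Prop :=
  𝒵 ⊆ X ∧ ∀ 𝒴, 𝒴 ⊆ X → ¬ ParetoDominates pref 𝒴 𝒵

end Election

/-! ## Matroid-constrained matching instances -/

/-- `r` (read `r x y` as `x ≻ y`) is a weak ranking of the elements of `s`: a strict partial order
on `s` whose induced indifference relation is transitive. -/
structure IsWeakRankingOn {O : Type*} (s : Set O) (r : O → O → Prop) : Prop where
  irrefl : ∀ x ∈ s, ¬ r x x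
  asymm : ∀ x ∈ s, ∀ y ∈ s, r x y → ¬ r y x
  trans : ∀ x ∈ s, ∀ y ∈ s, ∀ z ∈ s, r x y → r y z → r x z
  indiff_trans : ∀ x ∈ s, ∀ y ∈ s, ∀ z ∈ s,
    (¬ r x y ∧ ¬ r y x) → (¬ r y z ∧ ¬ r z y) → (¬ r x z ∧ ¬ r z x)

/-- A bipartite graph between agents `A` and objects `O`, for every agent a relation on objects
(of which only the values on objects adjacent to the agent matter), and a matroid on `O`. -/
structure MatchingInstance (A O : Type*) where
  /-- The edges of the bipartite graph. -/
  Adj : A → O → Prop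
  /-- `pref a o o'` says that agent `a` prefers object `o` to object `o'`. -/
  pref : A → O → O → Prop
  /-- The constraining matroid. -/
  matroid : Matroid O
  ground_eq : matroid.E = Set.univ

namespace MatchingInstance

variable {A O : Type*}

/-- Every agent's preference relation is a weak ranking of the objects adjacent to it. -/
def WeakRankings (I : MatchingInstance A O) : Prop :=
  ∀ a, IsWeakRankingOn {o | I.Adj a o} (I.pref a)

/-- A set of edges of the graph such that every node is incident to at most one of them. -/
def IsMatching (I : MatchingInstance A O) (M : Finset (A × O)) : Prop :=
  (∀ e ∈ M, I.Adj e.1 e.2) ∧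
  (∀ e ∈ M, ∀ f ∈ M, e.1 = f.1 → e = f) ∧
  (∀ e ∈ M, ∀ f ∈ M, e.2 = f.2 → e = f)

/-- The alternatives: matchings whose set of matched objects is independent. -/
def constrainedMatchings (I : MatchingInstance A O) : Set (Finset (A × O)) :=
  {M | I.IsMatching M ∧ I.matroid.Indep {o | ∃ a, (a, o) ∈ M}}

/-- Agent `a` prefers the matching `M` to the matching `N`: `a` is matched in `M`, and either `a` is
unmatched in `N` or `a` prefers its object in `M` to its object in `N`. -/
def prefMatching (I : MatchingInstance A O) (a : A) (M N : Finset (A × O)) : Prop :=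
  ∃ o, (a, o) ∈ M ∧ ∀ o', (a, o') ∈ N → I.pref a o o'

/-- Popular sets of constrained matchings. -/
def Popular (I : MatchingInstance A O) (𝓜 : Set (Finset (A × O))) : Prop :=
  IsPopular I.constrainedMatchings I.prefMatching 𝓜

/-- Pareto-optimal sets of constrained matchings. -/
def ParetoOptimal (I : MatchingInstance A O) (𝓜 : Set (Finset (A × O))) : Prop :=
  IsParetoOptimal I.constrainedMatchings I.prefMatching 𝓜

end MatchingInstance

/-! ## Random access machines with an oracle

Programs of a structured while-language over a random access memory of natural numbers. The memory
is organised in arrays: `s k i` is the entry with index `i` of the array number `k`. Which array is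
accessed is fixed in the program text, the index is computed. The operations are addition and
truncated subtraction, at unit cost; there is no multiplication, so that in `t` steps the bit length
of a number grows by at most `t` and unit cost is polynomially equivalent to Turing machine time. -/

/-- Memory contents. -/
abbrev Mem : Type := ℕ → ℕ → ℕ

/-- Overwrite the entry with index `i` of the array `k` by `v`. -/
def Mem.write (s : Mem) (k i v : ℕ) : Mem :=
  fun k' i' => if k' = k ∧ i' = i then v else s k' i'

/-- Arithmetic expressions. -/
inductive Expr where
  | const (c : ℕ)
  | read (k : ℕ) (i : Expr)
  | add (x y : Expr)
  | sub (x y : Expr)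

/-- The value of an expression; subtraction is truncated at zero. -/
def Expr.eval (s : Mem) : Expr → ℕ
  | .const c => c
  | .read k i => s k (i.eval s)
  | .add x y => x.eval s + y.eval s
  | .sub x y => x.eval s - y.eval s

/-- The number of steps for evaluating an expression: one for every node. -/
def Expr.cost : Expr → ℕ
  | .const _ => 1
  | .read _ i => 1 + i.cost
  | .add x y => 1 + x.cost + y.cost
  | .sub x y => 1 + x.cost + y.cost

/-- Programs. -/
inductive Prog where
  /-- do nothing -/
  | skip
  /-- set the entry with index `i` of the array `k` to `e` -/
  | assign (k : ℕ) (i e : Expr)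
  /-- ask the oracle about the set `{j | entry j of the array src is nonzero}` and write its answer
  (`1` for yes, `0` for no) to the entry `0` of the array `dst` -/
  | query (src dst : ℕ)
  /-- first `p`, then `q` -/
  | seq (p q : Prog)
  /-- `p` if the value of `e` is nonzero, and `q` otherwise -/
  | branch (e : Expr) (p q : Prog)
  /-- repeat `p` as long as the value of `e` is nonzero -/
  | loop (e : Expr) (p : Prog)

open Classical in
/-- The truth value of a proposition as a number. -/
noncomputable def bit (p : Prop) : ℕ := if p then 1 else 0

/-- `Exec orc p s t s'`: with the oracle `orc`, the program `p` started in memory `s` halts after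
exactly `t` steps in memory `s'`. An oracle call is one step. -/
inductive Exec (orc : Set ℕ → Prop) : Prog → Mem → ℕ → Mem → Prop where
  | skip (s : Mem) : Exec orc .skip s 1 s
  | assign (k : ℕ) (i e : Expr) (s : Mem) :
      Exec orc (.assign k i e) s (1 + i.cost + e.cost) (s.write k (i.eval s) (e.eval s))
  | query (src dst : ℕ) (s : Mem) :
      Exec orc (.query src dst) s 1 (s.write dst 0 (bit (orc {j | s src j ≠ 0})))
  | seq (p q : Prog) (s s₁ s₂ : Mem) (t₁ t₂ : ℕ) :
      Exec orc p s t₁ s₁ → Exec orc q s₁ t₂ s₂ → Exec orc (.seq p q) s (t₁ + t₂) s₂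
  | branch_true (e : Expr) (p q : Prog) (s s₁ : Mem) (t : ℕ) :
      e.eval s ≠ 0 → Exec orc p s t s₁ → Exec orc (.branch e p q) s (1 + e.cost + t) s₁
  | branch_false (e : Expr) (p q : Prog) (s s₁ : Mem) (t : ℕ) :
      e.eval s = 0 → Exec orc q s t s₁ → Exec orc (.branch e p q) s (1 + e.cost + t) s₁
  | loop_true (e : Expr) (p : Prog) (s s₁ s₂ : Mem) (t₁ t₂ : ℕ) :
      e.eval s ≠ 0 → Exec orc p s t₁ s₁ → Exec orc (.loop e p) s₁ t₂ s₂ →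
      Exec orc (.loop e p) s (1 + e.cost + t₁ + t₂) s₂
  | loop_false (e : Expr) (p : Prog) (s : Mem) :
      e.eval s = 0 → Exec orc (.loop e p) s (1 + e.cost) s

/-! ## Input and output -/

namespace MatchingInstance

variable {n m : ℕ}

/-- The initial memory for an instance with `n` agents and `m` objects: array `0` holds `n` and `m`,
array `1` the adjacency matrix, array `2` the comparisons `o ≻ₐ o'` between objects adjacent to `a`
(both row by row, as `0`-`1` entries), and all other entries are `0`. The matroid is not part of
it. -/
noncomputable def encode (I : MatchingInstance (Fin n) (Fin m)) : Mem
  | 0, 0 => n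
  | 0, 1 => m
  | 1, i => bit (∃ (a : Fin n) (o : Fin m), i = a * m + o ∧ I.Adj a o)
  | 2, i => bit (∃ (a : Fin n) (o o' : Fin m), i = (a * m + o) * m + o' ∧
      I.Adj a o ∧ I.Adj a o' ∧ I.pref a o o')
  | _, _ => 0

/-- The independence oracle: is the given set of objects independent? (Indices that are not
numbers of objects are ignored.) -/
def indepOracle (I : MatchingInstance (Fin n) (Fin m)) (S : Set ℕ) : Prop :=
  I.matroid.Indep {o : Fin m | (o : ℕ) ∈ S}

end MatchingInstance

/-- The set of agent-object pairs whose `n × m` incidence matrix is stored, row by row, in the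
array `k`. -/
def decode (n m : ℕ) (s : Mem) (k : ℕ) : Finset (Fin n × Fin m) :=
  Finset.univ.filter fun e => s k (e.1 * m + e.2) ≠ 0

end PopularSets

/-! Take two disjoint copies of every object and let `J` be the direct sum of two copies of the
matroid. A pair of constrained matchings that matches no agent twice is then a single assignment of
distinct, jointly `J`-independent elements to agents. Serve the agents one after the other: each
gets an element on the best level (indifference class, numbered by rank) on which this is possible
while all agents served before keep their levels; they may be moved within them.

One such step is an augmentation in an independent-matching problem. If it succeeds,
`IsChain.shorten` carries it out by successive exchanges. If it fails, `IsAssignment.blocks` turns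
the stuck search into a Rado-type certificate: a set `D` of earlier assigned agents such that the
elements on their levels have rank at most `|D|` and span the wanted element. A certificate mentions
levels only, so later exchanges cannot destroy it (`Blocks.congr`). In the end every improvement of
every agent is excluded by a certificate (`Certified`).

Pareto-optimality (`paretoOptimal_of_isSolution`): in a dominating pair, consider the first agent
that improves, with certificate `D`. The members of `D` come earlier, so they are tied, and their
objects together with the improving one are `|D| + 1` independent elements in the closure of a set
of rank at most `|D|`.

Popularity (`popular_of_isSolution`): let `R` be the union of all tight sets `D`, and `Q` the agents
that prefer `Z` to both matchings together with the members of `R` that are tied. Both copies of the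
objects that `Q` gets in `Z` are spanned by what `R` holds, and they are independent in `J`; hence
`2|Q| ≤ |R|`. Every member of `R` outside `Q` prefers one of the two matchings to `Z`, so at least
`|R| - |Q| ≥ |Q|` agents do.

The procedure is written in a language with counting loops only, whose running time is polynomial by
construction (`Code.exec_compile`). Existence is obtained from the same run. -/

namespace PopularSets

/-! ## Augmentation in matroid-constrained assignments -/

section Assignment

/-- The elements assigned to members of `S`; `f c = z + 1` means that `c` is assigned `z`. -/
def occ (f : ℕ → ℕ) (S : Set ℕ) : Set ℕ := {z | ∃ c ∈ S, f c = z + 1}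

theorem occ_mono {f : ℕ → ℕ} {S T : Set ℕ} (h : S ⊆ T) : occ f S ⊆ occ f T :=
  fun _ ⟨c, hc, e⟩ => ⟨c, h hc, e⟩

/-- An assignment of elements of a matroid to the agents below `n` such that the assigned elements
are distinct and independent, and every agent gets an element of its level. -/
structure IsAssignment (J : Matroid ℕ) (n : ℕ) (κ : ℕ → ℕ → ℕ) (lev f : ℕ → ℕ) : Prop where
  supp : ∀ c, n ≤ c → f c = 0
  inj : ∀ c d, f c = f d → f c ≠ 0 → c = d
  indep : J.Indep (occ f Set.univ)
  level_eq : ∀ c z, f c = z + 1 → κ c z = lev c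

/-- `z` is not spanned by the elements assigned to agents other than `b`. -/
def Avail (J : Matroid ℕ) (f : ℕ → ℕ) (b z : ℕ) : Prop :=
  z ∈ J.E ∧ z ∉ J.closure (occ f {b}ᶜ)

/-- The elements on the level of some member of `D`. -/
def levelSet (J : Matroid ℕ) (κ : ℕ → ℕ → ℕ) (lev : ℕ → ℕ) (D : Set ℕ) : Set ℕ :=
  {z | z ∈ J.E ∧ ∃ b ∈ D, κ b z = lev b}

variable {J : Matroid ℕ} {n : ℕ} {κ : ℕ → ℕ → ℕ} {lev f : ℕ → ℕ}

theorem occ_compl_of_eq_zero {b : ℕ} (h : f b = 0) : occ f {b}ᶜ = occ f Set.univ := by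
  apply Set.Subset.antisymm (occ_mono (Set.subset_univ _))
  rintro z ⟨c, -, e⟩
  refine ⟨c, ?_, e⟩
  rintro rfl
  omega

namespace IsAssignment

theorem occ_indep (hf : IsAssignment J n κ lev f) (S : Set ℕ) : J.Indep (occ f S) :=
  hf.indep.subset (occ_mono (Set.subset_univ _))

/-- Turns a closure condition into one that an independence oracle can decide. -/
theorem avail_iff (hf : IsAssignment J n κ lev f) {b z : ℕ} (hz : z ∈ J.E) :
    Avail J f b z ↔ z ∉ occ f {b}ᶜ ∧ J.Indep (insert z (occ f {b}ᶜ)) := by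
  rw [Avail, (hf.occ_indep _).notMem_closure_iff hz]
  tauto

theorem encard_occ (hf : IsAssignment J n κ lev f) {D : Set ℕ} (hD : ∀ c ∈ D, f c ≠ 0) :
    (occ f D).encard = D.encard := by
  have : occ f D = (fun c => f c - 1) '' D := by
    ext z
    constructor
    · rintro ⟨c, hc, e⟩
      exact ⟨c, hc, by simp [e]⟩
    · rintro ⟨c, hc, rfl⟩
      exact ⟨c, hc, by have := hD c hc; simp only; omega⟩
  rw [this, Set.InjOn.encard_image]
  intro c hc d hd e
  have h1 := hD c hc
  have h2 := hD d hd
  exact hf.inj c d (by simp only at e; omega) h1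

theorem occ_subset_levelSet (hf : IsAssignment J n κ lev f) (D : Set ℕ) :
    occ f D ⊆ levelSet J κ lev D := by
  rintro z ⟨c, hc, e⟩
  exact ⟨(hf.occ_indep D).subset_ground ⟨c, hc, e⟩, c, hc, hf.level_eq c z e⟩

/-- An element that is spanned by the assigned elements, but by none of the agents outside `R`
in an essential way, is spanned by the elements assigned to `R`. -/
theorem mem_closure_occ (hf : IsAssignment J n κ lev f) {R : Set ℕ} {z : ℕ}
    (hz : ∀ b, b ∉ R → z ∈ J.closure (occ f {b}ᶜ))
    (hz' : z ∈ J.closure (occ f Set.univ)) : z ∈ J.closure (occ f R) := by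
  -- Closure commutes with intersections of subsets of an independent set. The full set is added to
  -- the family to keep it nonempty when `R` contains every number.
  have key := hf.indep.closure_sInter_eq_biInter_closure_of_forall_subset
    (Js := insert (occ f Set.univ) {X | ∃ b, b ∉ R ∧ X = occ f {b}ᶜ}) ⟨_, Set.mem_insert _ _⟩
    (by
      rintro X (rfl | ⟨b, -, rfl⟩)
      · exact subset_rfl
      · exact occ_mono (Set.subset_univ _))
  have hmem : z ∈ J.closure (⋂₀ insert (occ f Set.univ) {X | ∃ b, b ∉ R ∧ X = occ f {b}ᶜ}) := by
    rw [key]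
    simp only [Set.mem_iInter]
    rintro X (rfl | ⟨b, hb, rfl⟩)
    · exact hz'
    · exact hz b hb
  refine J.closure_subset_closure ?_ hmem
  intro w hw
  obtain ⟨c, -, hc⟩ : w ∈ occ f Set.univ := hw _ (Set.mem_insert _ _)
  by_cases hcR : c ∈ R
  · exact ⟨c, hcR, hc⟩
  · obtain ⟨d, hd, e⟩ := hw (occ f {c}ᶜ) (Set.mem_insert_of_mem _ ⟨c, hcR, rfl⟩)
    exact absurd (hf.inj d c (by omega) (by omega)) hd

/-- If the search from the unassigned agent `a` gets stuck, then all elements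
wanted by reached agents are spanned by the elements assigned to them. -/
theorem mem_closure_of_stuck (hf : IsAssignment J n κ lev f) {R : Set ℕ} {a : ℕ} (ha : f a = 0)
    (hR : ∀ c ∈ R, ∀ z ∈ J.E, κ c z = lev c → ¬ Avail J f n z ∧
      ∀ b, f b ≠ 0 → Avail J f b z → b ∈ R) :
    ∀ c ∈ R, ∀ z ∈ J.E, κ c z = lev c → z ∈ J.closure (occ f (R \ {a})) := by
  intro c hc z hz hzc
  obtain ⟨h1, h2⟩ := hR c hc z hz hzc
  -- The number `n` never holds an element, so `Avail J f n z` refers to all assigned elements.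
  simp only [Avail, occ_compl_of_eq_zero (hf.supp n le_rfl), hz, true_and, not_not] at h1 h2
  have : occ f (R \ {a}) = occ f R := by
    apply Set.Subset.antisymm (occ_mono Set.sdiff_subset)
    rintro w ⟨d, hd, e⟩
    exact ⟨d, ⟨hd, by rintro rfl; omega⟩, e⟩
  rw [this]
  refine hf.mem_closure_occ (fun b hb => ?_) h1
  by_contra hcon
  by_cases hb0 : f b = 0
  · rw [occ_compl_of_eq_zero hb0] at hcon
    exact hcon h1
  · exact hb (h2 b hb0 hcon)

end IsAssignment

/-! ### Rado-type certificates -/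

/-- A set `D` of agents is a witness that an element `z` cannot be given to another agent as long as
all members of `D` have to get elements of their level. -/
def Blocks (J : Matroid ℕ) (κ : ℕ → ℕ → ℕ) (lev : ℕ → ℕ) (D : Set ℕ) (z : ℕ) : Prop :=
  J.eRk (levelSet J κ lev D) ≤ D.encard ∧ z ∈ J.closure (levelSet J κ lev D)

/-- The assignment itself does not occur in a certificate. This is what makes certificates survive
later augmentations. -/
theorem Blocks.congr {D : Set ℕ} {z : ℕ} {lev' : ℕ → ℕ} (h : Blocks J κ lev D z)
    (hlev : ∀ b ∈ D, lev' b = lev b) : Blocks J κ lev' D z := by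
  have : levelSet J κ lev' D = levelSet J κ lev D := by
    ext w
    refine and_congr_right fun _ => exists_congr fun b => and_congr_right fun hb => ?_
    rw [hlev b hb]
  rwa [Blocks, this]

/-- In a stuck search the reached agents other than `a` hold independent elements that span
everything on their levels, so the rank of these levels is at most the number of these agents; what
`a` wants is spanned as well. -/
theorem IsAssignment.blocks (hf : IsAssignment J n κ lev f) {R : Set ℕ} {a : ℕ} (ha : f a = 0)
    (haR : a ∈ R) (hR0 : ∀ c ∈ R, c ≠ a → f c ≠ 0)
    (hR : ∀ c ∈ R, ∀ z ∈ J.E, κ c z = lev c → ¬ Avail J f n z ∧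
      ∀ b, f b ≠ 0 → Avail J f b z → b ∈ R) {z : ℕ} (hz : z ∈ J.E) (hza : κ a z = lev a) :
    Blocks J κ lev (R \ {a}) z := by
  have key := hf.mem_closure_of_stuck ha hR
  have hsub : levelSet J κ lev (R \ {a}) ⊆ J.closure (occ f (R \ {a})) := by
    rintro w ⟨hw, b, hb, e⟩
    exact key b hb.1 w hw e
  constructor
  · refine (J.eRk_mono hsub).trans ?_
    rw [J.eRk_closure_eq, (hf.occ_indep _).eRk_eq_encard,
      hf.encard_occ (fun c hc => hR0 c hc.1 hc.2)]
  · exact J.closure_subset_closure (hf.occ_subset_levelSet _) (key a haR z hz hza)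

/-! ### Augmenting chains -/

/-- A sequence of distinct agents, starting with the unassigned agent `a`, in which every later
agent holds an element that is essential for spanning an element wanted by an earlier agent. -/
structure IsChain (J : Matroid ℕ) (n : ℕ) (κ : ℕ → ℕ → ℕ) (lev f : ℕ → ℕ) (a : ℕ)
    (st : ℕ → ℕ) (ℓ : ℕ) : Prop where
  zero : f a = 0
  first : st 0 = a
  lt : ∀ i < ℓ, st i < n
  inj : ∀ i < ℓ, ∀ j < ℓ, st i = st j → i = j
  ne_zero : ∀ i < ℓ, 0 < i → f (st i) ≠ 0
  link : ∀ i < ℓ, 0 < i → ∃ j < i, ∃ z, κ (st j) z = lev (st j) ∧ Avail J f (st i) z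

theorem IsChain.length_le {a : ℕ} {st : ℕ → ℕ} {ℓ : ℕ}
    (h : IsChain J n κ lev f a st ℓ) : ℓ ≤ n := by
  have := Finset.card_le_card_of_injOn (s := Finset.range ℓ) (t := Finset.range n) st
    (fun i hi => by simpa using h.lt i (by simpa using hi))
    (fun i hi j hj e => h.inj i (by simpa using hi) j (by simpa using hj) e)
  simpa using this

/-- The agent `c` can be given an element of its level without taking one away from others. -/
def CanTake (J : Matroid ℕ) (n : ℕ) (κ : ℕ → ℕ → ℕ) (lev f : ℕ → ℕ) (c z : ℕ) : Prop :=
  κ c z = lev c ∧ Avail J f n z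

theorem occ_update (f : ℕ → ℕ) (c z : ℕ) (S : Set ℕ) (hc : c ∈ S) :
    occ (Function.update f c (z + 1)) S = insert z (occ f (S \ {c})) := by
  ext w
  constructor
  · rintro ⟨d, hd, e⟩
    by_cases hdc : d = c
    · subst hdc
      rw [Function.update_self] at e
      left; omega
    · rw [Function.update_of_ne hdc] at e
      exact Or.inr ⟨d, ⟨hd, hdc⟩, e⟩
  · rintro (rfl | ⟨d, ⟨hd, hdc⟩, e⟩)
    · exact ⟨c, hc, Function.update_self ..⟩
    · exact ⟨d, hd, by rwa [Function.update_of_ne hdc]⟩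

/-- If adding `z` to `S` made `x` spanned, the exchange property would put `z` in the closure of `S`
with `x`, hence in the closure of `T`, which already spans `x`. -/
theorem notMem_closure_insert_of_exchange {S T : Set ℕ} (hST : S ⊆ T) {x z : ℕ}
    (hxT : x ∈ J.closure T) (hxS : x ∉ J.closure S) (hz : z ∉ J.closure T) :
    x ∉ J.closure (insert z S) := by
  intro hx
  have h1 := J.mem_closure_insert hxS hx
  apply hz
  have h2 : J.closure (insert x S) ⊆ J.closure (insert x T) :=
    J.closure_subset_closure (Set.insert_subset_insert hST)
  rw [Matroid.closure_insert_eq_of_mem_closure hxT] at h2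
  exact h2 h1

/-- The agent `c` releases any element it held before. Independence persists because `z` is not
spanned even by the full set of assigned elements. -/
theorem IsAssignment.update (hf : IsAssignment J n κ lev f) {c z : ℕ} (hc : c < n)
    (hz : CanTake J n κ lev f c z) :
    IsAssignment J n κ lev (Function.update f c (z + 1)) := by
  obtain ⟨hzc, hzE, hzcl⟩ := hz
  rw [occ_compl_of_eq_zero (hf.supp n le_rfl)] at hzcl
  have hnot : ∀ d, f d ≠ z + 1 := fun d hd =>
    hzcl (J.mem_closure_of_mem ⟨d, trivial, hd⟩ hf.indep.subset_ground)
  refine ⟨fun d hd => ?_, fun d e h h0 => ?_, ?_, fun d w h => ?_⟩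
  · rw [Function.update_of_ne (by omega)]
    exact hf.supp d hd
  · by_cases h1 : d = c <;> by_cases h2 : e = c
    · rw [h1, h2]
    · subst h1
      rw [Function.update_self, Function.update_of_ne h2] at h
      exact absurd h.symm (hnot e)
    · subst h2
      rw [Function.update_self, Function.update_of_ne h1] at h
      exact absurd h (hnot d)
    · rw [Function.update_of_ne h1, Function.update_of_ne h2] at h
      rw [Function.update_of_ne h1] at h0
      exact hf.inj d e h h0
  · rw [occ_update _ _ _ _ (Set.mem_univ _)]
    refine ((hf.occ_indep _).insert_indep_iff).2 (Or.inl ⟨hzE, fun hcl => hzcl ?_⟩)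
    exact J.closure_subset_closure (occ_mono (Set.subset_univ _)) hcl
  · by_cases h1 : d = c
    · subst h1
      rw [Function.update_self] at h
      obtain rfl : z = w := by omega
      exact hzc
    · rw [Function.update_of_ne h1] at h
      exact hf.level_eq d w h

/-- Giving a free element to the first agent of a chain that can take one shortens the chain. -/
theorem IsChain.shorten (hf : IsAssignment J n κ lev f) {a : ℕ} {st : ℕ → ℕ} {ℓ : ℕ}
    (hch : IsChain J n κ lev f a st ℓ) {j z : ℕ} (hj : j < ℓ)
    (hz : CanTake J n κ lev f (st j) z) (hno : ∀ i < j, ∀ w, ¬ CanTake J n κ lev f (st i) w)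
    (hj0 : 0 < j) :
    IsChain J n κ lev (Function.update f (st j) (z + 1)) a st j ∧
      ∃ i < j, ∃ w, CanTake J n κ lev (Function.update f (st j) (z + 1)) (st i) w := by
  have hzcl := hz.2.2
  rw [occ_compl_of_eq_zero (hf.supp n le_rfl)] at hzcl
  have hne : ∀ i < j, st i ≠ st j := fun i hi h => by
    have := hch.inj i (by omega) j hj h
    omega
  have hjn := hch.lt j hj
  -- Here the choice of the first agent that can take an element enters: everything wanted before
  -- position `j` is spanned, as the exchange lemma requires.
  have hspan : ∀ i < j, ∀ w, κ (st i) w = lev (st i) → w ∈ J.E →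
      w ∈ J.closure (occ f Set.univ) := by
    intro i hi w hw hwE
    by_contra hcon
    refine hno i hi w ⟨hw, hwE, ?_⟩
    rwa [occ_compl_of_eq_zero (hf.supp n le_rfl)]
  refine ⟨⟨?_, hch.first, fun i hi => hch.lt i (by omega),
    fun i hi k hk => hch.inj i (by omega) k (by omega), fun i hi hi0 => ?_, fun i hi hi0 => ?_⟩, ?_⟩
  · rw [Function.update_of_ne, hch.zero]
    rw [← hch.first]
    exact hne 0 hj0
  · rw [Function.update_of_ne (hne i hi)]
    exact hch.ne_zero i (by omega) hi0
  · obtain ⟨k, hk, w, hw, hwE, hwcl⟩ := hch.link i (by omega) hi0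
    refine ⟨k, hk, w, hw, hwE, ?_⟩
    rw [occ_update _ _ _ _ (by simpa using (hne i hi).symm)]
    refine notMem_closure_insert_of_exchange (occ_mono (Set.subset_univ _))
      (hspan k (by omega) w hw hwE) (fun h => hwcl ?_) hzcl
    exact J.closure_subset_closure (occ_mono Set.sdiff_subset) h
  -- Only the old element of `st j` kept `st k` from taking `w`. It is now released, and `z` does
  -- not span `w` in its place.
  · obtain ⟨k, hk, w, hw, hwE, hwcl⟩ := hch.link j hj hj0
    refine ⟨k, hk, w, hw, hwE, ?_⟩
    have h0 : Function.update f (st j) (z + 1) n = 0 := by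
      rw [Function.update_of_ne (by omega), hf.supp n le_rfl]
    rw [occ_compl_of_eq_zero h0, occ_update _ _ _ _ (Set.mem_univ _)]
    refine notMem_closure_insert_of_exchange (occ_mono (Set.subset_univ _))
      (hspan k hk w hw hwE) (fun h => hwcl ?_) hzcl
    rwa [Set.compl_eq_univ_sdiff]

end Assignment


/-! ## Programs with bounded loops only

`Code` is a fragment of the while-language in which all loops are counting loops. Its programs have
a functional semantics, and their running time is polynomial by construction. -/

/-- The value of a scalar variable: the entry `0` of its array. -/
abbrev Expr.var (k : ℕ) : Expr := .read k (.const 0)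

/-- Loop bounds: the number of agents, the number of objects, twice the number of objects. -/
inductive Bound where
  | agents
  | objects
  | copies

def Bound.expr : Bound → Expr
  | .agents => .read 0 (.const 0)
  | .objects => .read 0 (.const 1)
  | .copies => .add (.read 0 (.const 1)) (.read 0 (.const 1))

def Bound.val (n m : ℕ) : Bound → ℕ
  | .agents => n
  | .objects => m
  | .copies => m + m

theorem Bound.eval_expr (b : Bound) (s : Mem) : b.expr.eval s = b.val (s 0 0) (s 0 1) := by
  cases b <;> rfl

theorem Bound.val_le (b : Bound) (n m : ℕ) : b.val n m ≤ 2 * (n + m) := by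
  cases b <;> simp only [Bound.val] <;> omega

theorem Bound.cost_expr_le (b : Bound) : b.expr.cost ≤ 5 := by
  cases b <;> simp [Bound.expr, Expr.cost]

/-- Programs with counting loops; `forLt v b p` runs `p` for all values of the scalar variable `v`
below `b`. -/
inductive Code where
  | skip
  | assign (k : ℕ) (i e : Expr)
  | query (src dst : ℕ)
  | seq (p q : Code)
  | branch (e : Expr) (p q : Code)
  | forLt (v : ℕ) (b : Bound) (p : Code)

namespace Code

/-- Assignment to a scalar variable. -/
abbrev set (k : ℕ) (e : Expr) : Code := .assign k (.const 0) e

/-- The translation to the while-language. -/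
def compile : Code → Prog
  | .skip => .skip
  | .assign k i e => .assign k i e
  | .query src dst => .query src dst
  | .seq p q => .seq p.compile q.compile
  | .branch e p q => .branch e p.compile q.compile
  | .forLt v b p => .seq (.assign v (.const 0) (.const 0))
      (.loop (.sub b.expr (.var v))
        (.seq p.compile (.assign v (.const 0) (.add (.var v) (.const 1)))))

/-- The memory at the beginning of round `i` of a counting loop with body `g`. -/
def iterate (v : ℕ) (g : Mem → Mem) (s : Mem) : ℕ → Mem
  | 0 => s.write v 0 0
  | i + 1 => (g (iterate v g s i)).write v 0 (i + 1)

/-- The functional semantics. -/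
noncomputable def run (orc : Set ℕ → Prop) : Code → Mem → Mem
  | .skip, s => s
  | .assign k i e, s => s.write k (i.eval s) (e.eval s)
  | .query src dst, s => s.write dst 0 (bit (orc {j | s src j ≠ 0}))
  | .seq p q, s => q.run orc (p.run orc s)
  | .branch e p q, s => if e.eval s ≠ 0 then p.run orc s else q.run orc s
  | .forLt v b p, s => iterate v (p.run orc) s (b.val (s 0 0) (s 0 1))

/-- The arrays that a program may change. -/
def writes : Code → List ℕ
  | .skip => []
  | .assign k _ _ => [k]
  | .query _ dst => [dst]
  | .seq p q => p.writes ++ q.writes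
  | .branch _ p q => p.writes ++ q.writes
  | .forLt v _ p => v :: p.writes

/-- No loop variable is changed by the body of its loop. -/
def WellFormed : Code → Prop
  | .skip => True
  | .assign _ _ _ => True
  | .query _ _ => True
  | .seq p q => p.WellFormed ∧ q.WellFormed
  | .branch _ p q => p.WellFormed ∧ q.WellFormed
  | .forLt v _ p => v ∉ p.writes ∧ p.WellFormed

/-- A bound for the running time in terms of the number of agents and objects. -/
noncomputable def time : Code → Polynomial ℕ
  | .skip => 1
  | .assign _ i e => Polynomial.C (1 + i.cost + e.cost)
  | .query _ _ => 1
  | .seq p q => p.time + q.time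
  | .branch e p q => Polynomial.C (1 + e.cost) + p.time + q.time
  | .forLt _ _ p => 12 + 2 * Polynomial.X * (p.time + 15)

end Code

theorem Mem.write_apply_of_ne (s : Mem) {k k' : ℕ} (i v : ℕ) (h : k' ≠ k) :
    s.write k i v k' = s k' := by
  funext j
  simp [Mem.write, h]

theorem Mem.write_apply_self (s : Mem) (k i v : ℕ) :
    s.write k i v k = Function.update (s k) i v := by
  funext j
  by_cases h : j = i <;> simp [Mem.write, h]

namespace Code

section Run

variable (orc : Set ℕ → Prop) (s : Mem)

theorem run_skip : skip.run orc s = s := rfl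

theorem run_assign (k : ℕ) (i e : Expr) :
    (assign k i e).run orc s = s.write k (i.eval s) (e.eval s) := rfl

theorem run_query (src dst : ℕ) :
    (query src dst).run orc s = s.write dst 0 (bit (orc {j | s src j ≠ 0})) := rfl

theorem run_seq (p q : Code) : (seq p q).run orc s = q.run orc (p.run orc s) := rfl

theorem run_branch (e : Expr) (p q : Code) :
    (branch e p q).run orc s = if e.eval s ≠ 0 then p.run orc s else q.run orc s := rfl

end Run

/-- The frame rule, by which untouched arrays are carried through every verification below. -/
theorem run_apply_of_notMem (orc : Set ℕ → Prop) (p : Code) (s : Mem) {k : ℕ}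
    (h : k ∉ p.writes) : p.run orc s k = s k := by
  induction p generalizing s with
  | skip => rfl
  | assign k' i e => exact Mem.write_apply_of_ne _ _ _ (by simpa [writes] using h)
  | query src dst => exact Mem.write_apply_of_ne _ _ _ (by simpa [writes] using h)
  | seq p q hp hq =>
    simp only [writes, List.mem_append, not_or] at h
    rw [run, hq _ h.2, hp _ h.1]
  | branch e p q hp hq =>
    simp only [writes, List.mem_append, not_or] at h
    rw [run]
    split
    · exact hp _ h.1
    · exact hq _ h.2
  | forLt v b p hp =>
    simp only [writes, List.mem_cons, not_or] at h
    rw [run]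
    generalize b.val _ _ = B
    induction B with
    | zero => exact Mem.write_apply_of_ne _ _ _ h.1
    | succ i ih => rw [iterate, Mem.write_apply_of_ne _ _ _ h.1, hp _ h.2, ih]

theorem iterate_apply_of_notMem (orc : Set ℕ → Prop) (v : ℕ) (p : Code) (s : Mem) {k : ℕ}
    (hv : k ≠ v) (h : k ∉ p.writes) (i : ℕ) : iterate v (p.run orc) s i k = s k := by
  induction i with
  | zero => exact Mem.write_apply_of_ne _ _ _ hv
  | succ i ih => rw [iterate, Mem.write_apply_of_ne _ _ _ hv, run_apply_of_notMem _ _ _ h, ih]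

theorem iterate_apply_var (v : ℕ) (g : Mem → Mem) (s : Mem) (i : ℕ) :
    iterate v g s i v 0 = i := by
  cases i <;> simp [iterate, Mem.write]

/-- The invariant rule for counting loops. -/
theorem run_forLt_induction (orc : Set ℕ → Prop) {v : ℕ} {b : Bound} {p : Code} {s : Mem}
    (Inv : ℕ → Mem → Prop) (zero : Inv 0 (s.write v 0 0))
    (succ : ∀ i < b.val (s 0 0) (s 0 1), ∀ s', Inv i s' → s' v 0 = i →
      (∀ k, k ≠ v → k ∉ p.writes → s' k = s k) →
      Inv (i + 1) ((p.run orc s').write v 0 (i + 1))) :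
    Inv (b.val (s 0 0) (s 0 1)) ((forLt v b p).run orc s) := by
  rw [run]
  have : ∀ i ≤ b.val (s 0 0) (s 0 1), Inv i (iterate v (p.run orc) s i) := by
    intro i
    induction i with
    | zero => exact fun _ => zero
    | succ i ih =>
      intro hi
      exact succ i hi _ (ih (by omega)) (iterate_apply_var ..)
        (fun k hk hk' => iterate_apply_of_notMem orc v p s hk hk' i)
  exact this _ le_rfl

/-- The translation of a program computes its functional semantics in polynomial time. -/
theorem exec_compile (orc : Set ℕ → Prop) (p : Code) (hp : p.WellFormed) (h0 : 0 ∉ p.writes)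
    (s : Mem) :
    ∃ t, t ≤ p.time.eval (s 0 0 + s 0 1) ∧ Exec orc p.compile s t (p.run orc s) := by
  induction p generalizing s with
  | skip => exact ⟨1, by simp [time], .skip s⟩
  | assign k i e => exact ⟨_, by simp [time], .assign k i e s⟩
  | query src dst => exact ⟨1, by simp [time], .query src dst s⟩
  | seq p q ihp ihq =>
    simp only [writes, List.mem_append, not_or] at h0
    obtain ⟨t₁, ht₁, h₁⟩ := ihp hp.1 h0.1 s
    obtain ⟨t₂, ht₂, h₂⟩ := ihq hp.2 h0.2 (p.run orc s)
    rw [run_apply_of_notMem _ _ _ h0.1] at ht₂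
    exact ⟨_, by simp only [time, Polynomial.eval_add]; omega, .seq _ _ _ _ _ _ _ h₁ h₂⟩
  | branch e p q ihp ihq =>
    simp only [writes, List.mem_append, not_or] at h0
    simp only [time, Polynomial.eval_add, Polynomial.eval_C, run, compile]
    by_cases he : e.eval s = 0
    · obtain ⟨t, ht, h⟩ := ihq hp.2 h0.2 s
      rw [if_neg (by simpa using he)]
      exact ⟨_, by omega, .branch_false _ _ _ _ _ _ he h⟩
    · obtain ⟨t, ht, h⟩ := ihp hp.1 h0.1 s
      rw [if_pos he]
      exact ⟨_, by omega, .branch_true _ _ _ _ _ _ he h⟩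
  | forLt v b p ih =>
    simp only [writes, List.mem_cons, not_or] at h0
    obtain ⟨hv, hp⟩ := hp
    set N := s 0 0 + s 0 1 with hN
    set B := b.val (s 0 0) (s 0 1) with hB
    set σ := iterate v (p.run orc) s
    set T := p.time.eval N
    -- Array `0` is never written, so the loop bound and the time bound for the body are the same in
    -- all rounds.
    have h0' : ∀ i, σ i 0 = s 0 := iterate_apply_of_notMem orc v p s h0.1 h0.2
    have hvar : ∀ i, σ i v 0 = i := iterate_apply_var v _ s
    have heval : ∀ i, (Expr.sub b.expr (.var v)).eval (σ i) = B - i := by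
      intro i
      rw [Expr.eval, Bound.eval_expr, h0' i]
      change _ - σ i v 0 = _
      rw [hvar]
    have hcost : (Expr.sub b.expr (.var v)).cost ≤ 8 := by
      have := b.cost_expr_le
      simp only [Expr.cost]
      omega
    -- Induction on the number `d` of remaining rounds. A round costs at most 9 for the loop test,
    -- `T` for the body and 6 for the increment; the final failing test costs at most 9.
    have key : ∀ d ≤ B, ∃ t, t ≤ 9 + d * (T + 15) ∧ Exec orc
        (.loop (.sub b.expr (.var v))
          (.seq p.compile (.assign v (.const 0) (.add (.var v) (.const 1))))) (σ (B - d)) t (σ B) := by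
      intro d
      induction d with
      | zero =>
        intro _
        exact ⟨_, by omega, .loop_false _ _ _ (by rw [heval]; omega)⟩
      | succ d ihd =>
        intro hd
        obtain ⟨t, ht, h⟩ := ihd (by omega)
        obtain ⟨t', ht', h'⟩ := ih hp h0.2 (σ (B - (d + 1)))
        rw [h0' _] at ht'
        have hstep : Exec orc (.assign v (.const 0) (.add (.var v) (.const 1)))
            (p.run orc (σ (B - (d + 1)))) 6 (σ (B - d)) := by
          have := Exec.assign (orc := orc) v (.const 0) (.add (.var v) (.const 1))
            (p.run orc (σ (B - (d + 1))))
          have e1 : B - d = (B - (d + 1)) + 1 := by omega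
          simp only [Expr.eval, run_apply_of_notMem _ _ _ hv, hvar] at this
          rwa [e1]
        refine ⟨_, ?_, .loop_true _ _ _ _ _ _ _ (by rw [heval]; omega)
          (.seq _ _ _ _ _ _ _ h' hstep) h⟩
        have : t' ≤ T := ht'
        rw [Nat.add_mul]
        omega
    obtain ⟨t, ht, h⟩ := key B le_rfl
    rw [Nat.sub_self] at h
    refine ⟨_, ?_, .seq _ _ _ _ _ _ _ (.assign _ _ _ _) h⟩
    have h2 : B * (T + 15) ≤ 2 * N * (T + 15) := Nat.mul_le_mul_right _ (b.val_le _ _)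
    simp only [time, Polynomial.eval_add, Polynomial.eval_mul, Polynomial.eval_X,
      Polynomial.eval_ofNat, Expr.cost]
    change _ ≤ 12 + 2 * N * (T + 15)
    omega

end Code


/-! ## The program -/

namespace Solver

open Code

/-- Nonzero if and only if the two values differ. -/
def ne (x y : Expr) : Expr := .add (.sub x y) (.sub y x)

theorem eval_ne (x y : Expr) (s : Mem) : (ne x y).eval s ≠ 0 ↔ x.eval s ≠ y.eval s := by
  simp only [ne, Expr.eval]
  omega

/-- Clear array `11`. -/
def clear : Code := .forLt 30 .copies (.assign 11 (.var 30) (.const 0))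

/-- Mark the elements assigned to agents other than `s 24 0` in array `11`. -/
def mark : Code :=
  .forLt 30 .agents
    (.branch (ne (.var 30) (.var 24))
      (.branch (.read 7 (.var 30))
        (.assign 11 (.sub (.read 7 (.var 30)) (.const 1)) (.const 1)) .skip) .skip)

/-- Copy the second half of array `11` to array `12`. -/
def copyHalf : Code :=
  .forLt 30 .objects (.assign 12 (.var 30) (.read 11 (.add (.read 0 (.const 1)) (.var 30))))

/-- Decide whether the element `s 23 0` is not spanned by the elements assigned to agents other than
`s 24 0`. The answer is stored in array `13`. -/
def test : Code :=
  .seq clear (.seq mark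
  (.branch (.read 11 (.var 23)) (.set 13 (.const 0))
    (.seq (.assign 11 (.var 23) (.const 1))
    (.seq copyHalf
    (.seq (.query 11 13)
    (.seq (.query 12 14)
    (.branch (.var 14) .skip (.set 13 (.const 0)))))))))

/-- Nonzero if and only if the element `s 23 0` is not on the level of agent `s 9 (s 22 0)`. -/
def offLevel : Expr :=
  ne (.read 6 (.add (.read 5 (.read 9 (.var 22))) (.var 23))) (.read 8 (.read 9 (.var 22)))

/-- Append the agent `s 24 0` to the queue if it holds an element that is essential for spanning an
element wanted by the agent with index `s 22 0` in the queue. -/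
def discover : Code :=
  .branch (.sub (.var 15) (.var 22))
    (.branch offLevel .skip
      (.branch (.read 10 (.var 24)) .skip
        (.branch (.read 7 (.var 24))
          (.seq test (.branch (.var 13)
            (.seq (.assign 9 (.var 15) (.var 24))
            (.seq (.assign 10 (.var 24) (.const 1))
            (.set 15 (.add (.var 15) (.const 1))))) .skip)) .skip))) .skip

/-- Breadth first search. -/
def search : Code :=
  .forLt 22 .agents (.forLt 23 .copies (.forLt 24 .agents discover))

/-- Give the element `s 23 0` to the agent with index `s 22 0` in the queue and cut off the queue
there, if this is possible. -/
def take : Code :=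
  .branch (.sub (.var 15) (.var 22))
    (.branch offLevel .skip
      (.seq (.set 24 (.read 0 (.const 0)))
      (.seq test
      (.branch (.var 13)
        (.seq (.assign 7 (.read 9 (.var 22)) (.add (.var 23) (.const 1)))
        (.set 15 (.var 22))) .skip)))) .skip

/-- Let the first agent of the queue that can take an element do so. -/
def scan : Code := .forLt 22 .agents (.forLt 23 .copies take)

/-- Try to assign an element of its level to the agent `s 20 0`. -/
def augment : Code :=
  .seq (.forLt 24 .agents (.assign 10 (.var 24) (.const 0)))
  (.seq (.assign 10 (.var 20) (.const 1))
  (.seq (.assign 9 (.const 0) (.var 20))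
  (.seq (.set 15 (.const 1))
  (.seq search
  (.forLt 25 .agents scan)))))

/-- Serve the agents one after the other, each of them on the best possible level. -/
def serve : Code :=
  .forLt 20 .agents (.forLt 21 .objects
    (.branch (.read 7 (.var 20)) .skip
      (.seq (.assign 8 (.var 20) (.add (.var 21) (.const 1))) augment)))

/-- Compute the tables `s 18 a = a * m` and `s 5 a = a * (2 * m)`. -/
def tables : Code :=
  .seq (.set 16 (.const 0)) (.seq (.set 17 (.const 0))
  (.forLt 20 .agents
    (.seq (.assign 18 (.var 20) (.var 16))
    (.seq (.assign 5 (.var 20) (.var 17))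
    (.seq (.set 16 (.add (.var 16) (.read 0 (.const 1))))
    (.set 17 (.add (.var 17) (.add (.read 0 (.const 1)) (.read 0 (.const 1))))))))))

/-- Add the comparison of the objects `s 22 0` and `s 21 0` by agent `s 20 0` to `s 17 0`. -/
def compare : Code :=
  .seq (.set 16 (.const 0))
  (.seq (.forLt 23 .objects
    (.set 16 (.add (.var 16) (.add (.read 18 (.var 20)) (.var 22)))))
  (.set 17 (.add (.var 17) (.read 2 (.add (.var 16) (.var 21))))))

/-- Compute the ranks of the objects. -/
def ranks : Code :=
  .forLt 20 .agents (.forLt 21 .objects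
    (.seq (.set 17 (.const 0))
    (.seq (.forLt 22 .objects compare)
    (.seq (.branch (.read 1 (.add (.read 18 (.var 20)) (.var 21)))
      (.set 17 (.add (.var 17) (.const 1))) (.set 17 (.const 0)))
    (.seq (.assign 6 (.add (.read 5 (.var 20)) (.var 21)) (.var 17))
    (.assign 6 (.add (.read 5 (.var 20)) (.add (.read 0 (.const 1)) (.var 21))) (.var 17)))))))

/-- Write the incidence matrices of the two matchings to the arrays `3` and `4`. -/
def output : Code :=
  .forLt 20 .agents (.forLt 21 .objects
    (.seq (.assign 3 (.add (.read 18 (.var 20)) (.var 21))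
      (.sub (.const 1) (ne (.read 7 (.var 20)) (.add (.var 21) (.const 1)))))
    (.assign 4 (.add (.read 18 (.var 20)) (.var 21))
      (.sub (.const 1) (ne (.read 7 (.var 20))
        (.add (.add (.read 0 (.const 1)) (.var 21)) (.const 1)))))))

/-- The whole program. -/
def main : Code := .seq tables (.seq ranks (.seq serve output))

theorem main_wellFormed : main.WellFormed ∧ 0 ∉ main.writes := by
  simp [main, tables, ranks, compare, serve, output, augment, search, discover, take, scan, test,
    clear, mark, copyHalf,     WellFormed, writes]

/-! ### Correctness of the independence test -/

theorem bit_ne_zero (p : Prop) : bit p ≠ 0 ↔ p := by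
  unfold bit
  split <;> simp_all

/-- The matroid `J` consists of two copies of a matroid on the numbers below `m` with independence
oracle `orc`. -/
structure IsDouble (orc : Set ℕ → Prop) (m : ℕ) (J : Matroid ℕ) : Prop where
  ground : ∀ z, z ∈ J.E ↔ z < m + m
  indep : ∀ X, J.Indep X ↔ X ⊆ J.E ∧ orc X ∧ orc {o | m + o ∈ X}
  congr : ∀ X Y, (∀ o < m, o ∈ X ↔ o ∈ Y) → (orc X ↔ orc Y)

variable {orc : Set ℕ → Prop} {n m : ℕ} {J : Matroid ℕ} {κ : ℕ → ℕ → ℕ} {lev f : ℕ → ℕ}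

theorem run_clear {s : Mem} (hm : s 0 1 = m) :
    ∀ q < m + m, clear.run orc s 11 q = 0 := by
  have := run_forLt_induction orc (v := 30) (b := .copies)
    (p := .assign 11 (.var 30) (.const 0)) (s := s)
    (fun i s' => ∀ q < i, s' 11 q = 0) (by simp) (by
      intro i _ s' hs' hv _ q hq
      simp only [run_assign, Expr.eval, Mem.write_apply_of_ne _ _ _ (show 11 ≠ 30 by simp),
        Mem.write_apply_self, hv, Function.update_apply]
      split_ifs with hqi
      · rfl
      · exact hs' q (by omega))
  rwa [Bound.val, hm] at this

theorem run_mark {s : Mem} (hn : s 0 0 = n) (h0 : ∀ q < m + m, s 11 q = 0)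
    (hsupp : ∀ c, n ≤ c → s 7 c = 0) :
    ∀ q < m + m, mark.run orc s 11 q ≠ 0 ↔ q ∈ occ (s 7) {s 24 0}ᶜ := by
  have := run_forLt_induction orc (v := 30) (b := .agents)
    (p := .branch (ne (.var 30) (.var 24))
      (.branch (.read 7 (.var 30))
        (.assign 11 (.sub (.read 7 (.var 30)) (.const 1)) (.const 1)) .skip) .skip) (s := s)
    (fun i s' => ∀ q < m + m, s' 11 q ≠ 0 ↔ ∃ c < i, c ≠ s 24 0 ∧ s 7 c = q + 1)
    (by simpa [Mem.write_apply_of_ne] using h0) (by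
      intro i _ s' hs' hv hk q hq
      have e7 : s' 7 = s 7 := hk 7 (by simp) (by simp [writes])
      have e24 : s' 24 = s 24 := hk 24 (by simp) (by simp [writes])
      have hq' := hs' q hq
      have hstep : (∃ c < i + 1, c ≠ s 24 0 ∧ s 7 c = q + 1) ↔
          (∃ c < i, c ≠ s 24 0 ∧ s 7 c = q + 1) ∨ (i ≠ s 24 0 ∧ s 7 i = q + 1) := by
        simp only [Nat.lt_succ_iff_lt_or_eq, or_and_right, exists_or, exists_eq_left]
      rw [Mem.write_apply_of_ne _ _ _ (by simp), hstep]
      simp only [run_branch, run_assign, run_skip, eval_ne]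
      simp only [Expr.eval, hv, e7, e24]
      split_ifs with hi1 hi2
      · rw [Mem.write_apply_self, Function.update_apply]
        split_ifs with hqi
        · simp only [ne_eq, one_ne_zero, not_false_eq_true, true_iff]
          exact Or.inr ⟨hi1, by omega⟩
        · rw [hq', or_iff_left]
          rintro ⟨-, h⟩
          omega
      · rw [hq', or_iff_left]
        rintro ⟨-, h⟩
        omega
      · rw [hq', or_iff_left]
        rintro ⟨h, -⟩
        exact hi1 h)
  rw [Bound.val, hn] at this
  intro q hq
  refine (this q hq).trans ⟨fun ⟨c, _, hc, h⟩ => ⟨c, hc, h⟩, fun ⟨c, hc, h⟩ => ⟨c, ?_, hc, h⟩⟩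
  by_contra hcn
  have := hsupp c (by omega)
  omega

theorem run_copyHalf {s : Mem} (hm : s 0 1 = m) :
    ∀ q < m, copyHalf.run orc s 12 q = s 11 (m + q) := by
  have := run_forLt_induction orc (v := 30) (b := .objects)
    (p := .assign 12 (.var 30) (.read 11 (.add (.read 0 (.const 1)) (.var 30)))) (s := s)
    (fun i s' => ∀ q < i, s' 12 q = s 11 (m + q)) (by simp) (by
      intro i _ s' hs' hv hk q hq
      rw [Mem.write_apply_of_ne _ _ _ (by simp)]
      simp only [run_assign, Expr.eval, hv]
      rw [Mem.write_apply_self, Function.update_apply, hk 11 (by simp) (by simp [writes]),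
        hk 0 (by simp) (by simp [writes]), hm]
      split_ifs with hqi
      · rw [hqi]
      · exact hs' q (by omega))
  rwa [Bound.val, hm] at this

/-- By `avail_iff`, not being spanned means being absent and keeping independence when added. The
absence check on array `11` is needed because inserting an element already present would change
nothing. -/
theorem run_test (hJ : IsDouble orc m J) {s : Mem} (hn : s 0 0 = n) (hm : s 0 1 = m)
    (hf : IsAssignment J n κ lev (s 7)) (hz : s 23 0 < m + m) :
    (test.run orc s) 13 0 ≠ 0 ↔ Avail J (s 7) (s 24 0) (s 23 0) := by
  have hzE := (hJ.ground _).2 hz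
  have hocc : ∀ x, ∀ q ∈ occ (s 7) x, q < m + m := fun x q hq =>
    (hJ.ground q).1 ((hf.occ_indep x).subset_ground hq)
  rw [hf.avail_iff hzE]
  have h₁ : ∀ k, k ≠ 30 → k ≠ 11 → clear.run orc s k = s k := fun k h h' =>
    run_apply_of_notMem _ _ _ (by simp [clear, writes, h, h'])
  have h₂ : ∀ k, k ≠ 30 → k ≠ 11 → mark.run orc (clear.run orc s) k = s k := fun k h h' => by
    rw [run_apply_of_notMem _ _ _ (by simp [mark, writes, h, h']), h₁ k h h']
  have hq₂ := run_mark (orc := orc) (n := n) (m := m) (s := clear.run orc s)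
    (by rwa [h₁ 0 (by simp) (by simp)]) (run_clear hm)
    (by rw [h₁ 7 (by simp) (by simp)]; exact hf.supp)
  rw [h₁ 7 (by simp) (by simp), h₁ 24 (by simp) (by simp)] at hq₂
  rw [test, run_seq, run_seq]
  generalize mark.run orc (clear.run orc s) = s₂ at h₂ hq₂
  have hz₂ : (Expr.read 11 (.var 23)).eval s₂ ≠ 0 ↔ s 23 0 ∈ occ (s 7) {s 24 0}ᶜ := by
    rw [← hq₂ _ hz, Expr.eval, Expr.eval, h₂ 23 (by simp) (by simp)]
    rfl
  rw [run_branch]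
  split_ifs with h
  · rw [run_assign, Mem.write_apply_self]
    simp [Expr.eval, hz₂.1 h]
  rw [hz₂] at h
  rw [and_iff_right h, run_seq, run_seq, run_assign]
  generalize hs₃ : s₂.write 11 _ _ = s₃
  have h₃ : ∀ q, q < m + m → (s₃ 11 q ≠ 0 ↔ q ∈ insert (s 23 0) (occ (s 7) {s 24 0}ᶜ)) := by
    intro q hq
    rw [← hs₃, Mem.write_apply_self, Function.update_apply]
    simp only [Expr.eval, h₂ 23 (by simp) (by simp), Set.mem_insert_iff, ← hq₂ q hq]
    split_ifs with hqz <;> simp [hqz]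
  have hcopy := run_copyHalf (orc := orc) (m := m) (s := s₃) (by
    rw [← hs₃, Mem.write_apply_of_ne _ _ _ (by simp), h₂ 0 (by simp) (by simp), hm])
  have h₄ : copyHalf.run orc s₃ 11 = s₃ 11 :=
    run_apply_of_notMem _ _ _ (by simp [copyHalf, writes])
  generalize copyHalf.run orc s₃ = s₄ at hcopy h₄
  have hsub : insert (s 23 0) (occ (s 7) {s 24 0}ᶜ) ⊆ J.E := by
    rintro q (rfl | hq)
    · exact hzE
    · exact (hJ.ground q).2 (hocc _ q hq)
  -- Independence in the double splits into one query per copy. The oracle ignores indices from `m`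
  -- on, so array `11` itself serves for the first copy.
  rw [hJ.indep, and_iff_right hsub,
    ← hJ.congr {j | s₄ 11 j ≠ 0} (insert (s 23 0) (occ (s 7) {s 24 0}ᶜ))
      (fun o ho => by rw [← h₃ o (by omega), h₄]; rfl),
    ← hJ.congr {j | s₄ 12 j ≠ 0} {o | m + o ∈ insert (s 23 0) (occ (s 7) {s 24 0}ᶜ)}
      (fun o ho => by
        rw [Set.mem_ofPred_eq, Set.mem_ofPred_eq, ← h₃ (m + o) (by omega), hcopy o ho])]
  rw [run_seq, run_seq, run_query, run_query]
  generalize hs₅ : s₄.write 13 0 _ = s₅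
  have h13 : s₅ 13 0 = bit (orc {j | s₄ 11 j ≠ 0}) := by
    rw [← hs₅, Mem.write_apply_self, Function.update_self]
  have h12 : s₅ 12 = s₄ 12 := by rw [← hs₅, Mem.write_apply_of_ne _ _ _ (by simp)]
  rw [h12, run_branch, run_skip, run_assign]
  split_ifs with h14
  all_goals
    simp only [Expr.eval] at h14
    rw [Mem.write_apply_self, Function.update_self, bit_ne_zero] at h14
  · rw [Mem.write_apply_of_ne _ _ _ (by simp), h13, bit_ne_zero, and_iff_left h14]
  · rw [Mem.write_apply_self]
    simp [h14, Expr.eval]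

/-! ### Correctness of the breadth first search -/

/-- The memory holds the numbers of agents and objects and the table `κ`. -/
structure HasTables (n m : ℕ) (κ : ℕ → ℕ → ℕ) (s : Mem) : Prop where
  agents : s 0 0 = n
  objects : s 0 1 = m
  level : ∀ c < n, ∀ z < m + m, s 6 (s 5 c + z) = κ c z

theorem HasTables.congr {s s' : Mem} (h : HasTables n m κ s) (h0 : s' 0 = s 0) (h5 : s' 5 = s 5)
    (h6 : s' 6 = s 6) : HasTables n m κ s' := by
  refine ⟨?_, ?_, ?_⟩
  · rw [h0, h.agents]
  · rw [h0, h.objects]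
  · rw [h5, h6]
    exact h.level

theorem HasTables.eval_offLevel {s : Mem} (h : HasTables n m κ s) (hj : s 9 (s 22 0) < n)
    (hz : s 23 0 < m + m) :
    offLevel.eval s ≠ 0 ↔ κ (s 9 (s 22 0)) (s 23 0) ≠ s 8 (s 9 (s 22 0)) := by
  rw [offLevel, eval_ne]
  simp only [Expr.eval]
  rw [h.level _ hj _ hz]

theorem run_discover (hJ : IsDouble orc m J) {s : Mem} (hs : HasTables n m κ s)
    (hf : IsAssignment J n κ lev (s 7)) (hz : s 23 0 < m + m)
    (hj : s 22 0 < s 15 0 → s 9 (s 22 0) < n) :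
    ((s 22 0 < s 15 0 ∧ κ (s 9 (s 22 0)) (s 23 0) = s 8 (s 9 (s 22 0)) ∧ s 10 (s 24 0) = 0 ∧
        s 7 (s 24 0) ≠ 0 ∧ Avail J (s 7) (s 24 0) (s 23 0)) ∧
      discover.run orc s 9 = Function.update (s 9) (s 15 0) (s 24 0) ∧
      discover.run orc s 10 = Function.update (s 10) (s 24 0) 1 ∧
      discover.run orc s 15 0 = s 15 0 + 1) ∨
    (¬ (s 22 0 < s 15 0 ∧ κ (s 9 (s 22 0)) (s 23 0) = s 8 (s 9 (s 22 0)) ∧ s 10 (s 24 0) = 0 ∧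
        s 7 (s 24 0) ≠ 0 ∧ Avail J (s 7) (s 24 0) (s 23 0)) ∧
      discover.run orc s 9 = s 9 ∧ discover.run orc s 10 = s 10 ∧
      discover.run orc s 15 0 = s 15 0) := by
  have h1 : (Expr.sub (.var 15) (.var 22)).eval s ≠ 0 ↔ s 22 0 < s 15 0 := by
    simp only [Expr.eval]
    omega
  rw [discover, run_branch]
  by_cases hlt : s 22 0 < s 15 0
  swap
  · rw [if_neg (by rwa [h1])]
    exact Or.inr ⟨fun h => hlt h.1, rfl, rfl, rfl⟩
  rw [if_pos (h1.2 hlt), run_branch]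
  have h2 := hs.eval_offLevel (hj hlt) hz
  by_cases hlev : κ (s 9 (s 22 0)) (s 23 0) = s 8 (s 9 (s 22 0))
  swap
  · rw [if_pos (h2.2 hlev)]
    exact Or.inr ⟨fun h => hlev h.2.1, rfl, rfl, rfl⟩
  rw [if_neg (by rw [h2, not_not]; exact hlev), run_branch]
  have h3 : (Expr.read 10 (.var 24)).eval s = s 10 (s 24 0) := rfl
  by_cases h10 : s 10 (s 24 0) = 0
  swap
  · rw [if_pos (by rwa [h3])]
    exact Or.inr ⟨fun h => h10 h.2.2.1, rfl, rfl, rfl⟩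
  rw [if_neg (by rw [h3, not_not]; exact h10), run_branch]
  have h4 : (Expr.read 7 (.var 24)).eval s = s 7 (s 24 0) := rfl
  by_cases h7 : s 7 (s 24 0) = 0
  · rw [if_neg (by rw [h4, not_not]; exact h7)]
    exact Or.inr ⟨fun h => h.2.2.2.1 h7, rfl, rfl, rfl⟩
  rw [if_pos (by rwa [h4]), run_seq, run_branch]
  have htest := run_test hJ hs.agents hs.objects hf hz
  have hframe : ∀ k, k ∉ [30, 11, 12, 13, 14] → test.run orc s k = s k := fun k hk =>
    run_apply_of_notMem _ _ _ (by simp [test, clear, mark, copyHalf, writes] at hk ⊢; tauto)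
  generalize test.run orc s = s' at htest hframe
  have e9 := hframe 9 (by simp)
  have e10 := hframe 10 (by simp)
  have e15 := hframe 15 (by simp)
  have e24 := hframe 24 (by simp)
  have h5 : (Expr.var 13).eval s' = s' 13 0 := rfl
  by_cases hav : Avail J (s 7) (s 24 0) (s 23 0)
  · rw [if_pos (by rw [h5]; exact htest.2 hav)]
    refine Or.inl ⟨⟨hlt, hlev, h10, h7, hav⟩, ?_⟩
    simp only [run_seq, run_assign, Expr.eval, Mem.write_apply_self,
      Mem.write_apply_of_ne _ _ _ (show 9 ≠ 15 by simp),
      Mem.write_apply_of_ne _ _ _ (show 9 ≠ 10 by simp),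
      Mem.write_apply_of_ne _ _ _ (show 10 ≠ 15 by simp),
      Mem.write_apply_of_ne _ _ _ (show 10 ≠ 9 by simp),
      Mem.write_apply_of_ne _ _ _ (show 15 ≠ 10 by simp),
      Mem.write_apply_of_ne _ _ _ (show 15 ≠ 9 by simp),
      Mem.write_apply_of_ne _ _ _ (show 24 ≠ 9 by simp), e9, e10, e15, e24,
      Function.update_self, and_self]
  · rw [if_neg (by rw [h5]; exact fun h => hav (htest.1 h)), run_skip]
    exact Or.inr ⟨fun h => hav h.2.2.2.2, e9, e10, by rw [e15]⟩

/-- The invariant of the breadth first search; `D` is the set of triples of an index of the queue,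
an element and an agent that have been treated. -/
structure SearchInv (n m : ℕ) (J : Matroid ℕ) (κ : ℕ → ℕ → ℕ) (lev f : ℕ → ℕ) (a : ℕ)
    (D : ℕ → ℕ → ℕ → Prop) (s : Mem) : Prop where
  tables : HasTables n m κ s
  assigned : s 7 = f
  levels : s 8 = lev
  chain : IsChain J n κ lev f a (s 9) (s 15 0)
  pos : 0 < s 15 0
  mem_iff : ∀ c < n, s 10 c ≠ 0 ↔ ∃ i < s 15 0, s 9 i = c
  done : ∀ i z b, D i z b → i < s 15 0 → κ (s 9 i) z = lev (s 9 i) → f b ≠ 0 →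
    Avail J f b z → ∃ i' < s 15 0, s 9 i' = b

theorem SearchInv.congr {a : ℕ} {D D' : ℕ → ℕ → ℕ → Prop} {s : Mem} {k i v : ℕ}
    (h : SearchInv n m J κ lev f a D s) (hD : ∀ i z b, D' i z b → D i z b)
    (hk : k ∉ [0, 5, 6, 7, 8, 9, 10, 15]) :
    SearchInv n m J κ lev f a D' (s.write k i v) := by
  have hw : ∀ k' ∈ [0, 5, 6, 7, 8, 9, 10, 15], s.write k i v k' = s k' := fun k' hk' =>
    Mem.write_apply_of_ne _ _ _ (by rintro rfl; exact hk hk')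
  refine ⟨h.tables.congr (hw 0 (by simp)) (hw 5 (by simp)) (hw 6 (by simp)), ?_, ?_, ?_, ?_, ?_, ?_⟩
  · rw [hw 7 (by simp), h.assigned]
  · rw [hw 8 (by simp), h.levels]
  · rw [hw 9 (by simp), hw 15 (by simp)]
    exact h.chain
  · rw [hw 15 (by simp)]
    exact h.pos
  · rw [hw 10 (by simp), hw 9 (by simp), hw 15 (by simp)]
    exact h.mem_iff
  · rw [hw 9 (by simp), hw 15 (by simp)]
    exact fun i z b hb => h.done i z b (hD i z b hb)

/-- A new agent is appended behind the current index, while all treated triples have an index at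
most the current one; so nothing is yet claimed about the new entry. The triple just treated is
settled by the new entry or by an earlier one. -/
theorem SearchInv.discover (hJ : IsDouble orc m J) {a : ℕ} {D : ℕ → ℕ → ℕ → Prop} {s : Mem}
    (h : SearchInv n m J κ lev f a D s) (hf : IsAssignment J n κ lev f)
    (hD : ∀ i z b, D i z b → i ≤ s 22 0) (hz : s 23 0 < m + m) (hb : s 24 0 < n) :
    SearchInv n m J κ lev f a
      (fun i z b => D i z b ∨ i = s 22 0 ∧ z = s 23 0 ∧ b = s 24 0) (discover.run orc s) := by
  have hframe : ∀ k, k ∉ [30, 11, 12, 13, 14, 9, 10, 15] → Solver.discover.run orc s k = s k :=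
    fun k hk => run_apply_of_notMem _ _ _
      (by simp [Solver.discover, test, clear, mark, copyHalf, writes] at hk ⊢; tauto)
  have key := run_discover hJ h.tables (by rw [h.assigned]; exact hf) hz
    (fun hlt => h.chain.lt _ hlt)
  generalize Solver.discover.run orc s = s' at hframe key
  rw [h.assigned, h.levels] at key
  have ht : HasTables n m κ s' :=
    h.tables.congr (hframe 0 (by simp)) (hframe 5 (by simp)) (hframe 6 (by simp))
  have h7 : s' 7 = f := by rw [hframe 7 (by simp), h.assigned]
  have h8 : s' 8 = lev := by rw [hframe 8 (by simp), h.levels]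
  rcases key with ⟨⟨hlt, hlev, h10, hfb, hav⟩, e9, e10, e15⟩ | ⟨hno, e9, e10, e15⟩
  · have hnew : ∀ i < s 15 0, s 9 i ≠ s 24 0 := fun i hi e =>
      (h.mem_iff _ hb).2 ⟨i, hi, e⟩ h10
    have e9' : ∀ i < s 15 0, s' 9 i = s 9 i := fun i hi => by
      rw [e9, Function.update_of_ne (by omega)]
    have e9'' : s' 9 (s 15 0) = s 24 0 := by rw [e9, Function.update_self]
    have hpos := h.pos
    have hc := h.chain
    refine ⟨ht, h7, h8, ⟨hc.zero, ?_, ?_, ?_, ?_, ?_⟩, by omega, ?_, ?_⟩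
    · rw [e9' 0 hpos, hc.first]
    · intro i hi
      rcases Nat.lt_succ_iff_lt_or_eq.1 (e15 ▸ hi) with hi | rfl
      · rw [e9' i hi]
        exact hc.lt i hi
      · rwa [e9'']
    · intro i hi j hj e
      rcases Nat.lt_succ_iff_lt_or_eq.1 (e15 ▸ hi) with hi | rfl <;>
        rcases Nat.lt_succ_iff_lt_or_eq.1 (e15 ▸ hj) with hj | rfl
      · rw [e9' i hi, e9' j hj] at e
        exact hc.inj i hi j hj e
      · rw [e9' i hi, e9''] at e
        exact absurd e (hnew i hi)
      · rw [e9' j hj, e9''] at e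
        exact absurd e.symm (hnew j hj)
      · rfl
    · intro i hi hi0
      rcases Nat.lt_succ_iff_lt_or_eq.1 (e15 ▸ hi) with hi | rfl
      · rw [e9' i hi]
        exact hc.ne_zero i hi hi0
      · rwa [e9'']
    · intro i hi hi0
      rcases Nat.lt_succ_iff_lt_or_eq.1 (e15 ▸ hi) with hi | rfl
      · obtain ⟨j, hj, z, hz⟩ := hc.link i hi hi0
        refine ⟨j, hj, z, ?_⟩
        rwa [e9' i hi, e9' j (by omega)]
      · refine ⟨s 22 0, hlt, s 23 0, ?_⟩
        rw [e9' _ hlt, e9'']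
        exact ⟨hlev, hav⟩
    · intro c hcn
      rw [e10, e15, Function.update_apply]
      split_ifs with hcb
      · simp only [ne_eq, one_ne_zero, not_false_eq_true, true_iff]
        exact ⟨s 15 0, by omega, by rw [e9'', hcb]⟩
      · rw [h.mem_iff c hcn]
        constructor
        · rintro ⟨i, hi, e⟩
          exact ⟨i, by omega, by rw [e9' i hi, e]⟩
        · rintro ⟨i, hi, e⟩
          rcases Nat.lt_succ_iff_lt_or_eq.1 hi with hi | rfl
          · exact ⟨i, hi, by rw [← e9' i hi, e]⟩
          · rw [e9''] at e
            exact absurd e.symm hcb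
    · rintro i z b hD' hi hκ hfb' hav'
      rw [e15]
      rcases hD' with hD' | ⟨rfl, rfl, rfl⟩
      · have hi' : i < s 15 0 := by
          have := hD i z b hD'
          omega
        rw [e9' i hi'] at hκ
        obtain ⟨i', hi', e⟩ := h.done i z b hD' hi' hκ hfb' hav'
        exact ⟨i', by omega, by rw [e9' i' hi', e]⟩
      · exact ⟨s 15 0, by omega, e9''⟩
  · refine ⟨ht, h7, h8, ?_, ?_, ?_, ?_⟩
    · rw [e9, e15]
      exact h.chain
    · rw [e15]
      exact h.pos
    · rw [e9, e10, e15]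
      exact h.mem_iff
    · rw [e9, e15]
      rintro i z b (hD' | ⟨rfl, rfl, rfl⟩) hi hκ hfb' hav'
      · exact h.done i z b hD' hi hκ hfb' hav'
      · by_contra hcon
        refine hno ⟨hi, hκ, ?_, hfb', hav'⟩
        by_contra h10
        exact hcon ((h.mem_iff _ hb).1 h10)

/-- The queue grows while the outer loop runs, but only behind the current index, so every entry is
treated when its turn comes; indices beyond the end of the queue are skipped. -/
theorem SearchInv.search (hJ : IsDouble orc m J) {a : ℕ} {s : Mem}
    (h : SearchInv n m J κ lev f a (fun _ _ _ => False) s) (hf : IsAssignment J n κ lev f) :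
    SearchInv n m J κ lev f a (fun i z b => i < n ∧ z < m + m ∧ b < n) (search.run orc s) := by
  have hw : 22 ∉ Solver.discover.writes ∧ 23 ∉ Solver.discover.writes := by
    simp [Solver.discover, test, clear, mark, copyHalf, writes]
  have hn := h.tables.agents
  have hm := h.tables.objects
  have houter := run_forLt_induction orc (v := 22) (b := .agents)
    (p := .forLt 23 .copies (.forLt 24 .agents Solver.discover)) (s := s)
    (fun j s' => SearchInv n m J κ lev f a (fun i z b => i < j ∧ z < m + m ∧ b < n) s')
    (h.congr (by simp) (by simp)) (by
      intro j hj s₁ h₁ hj₁ _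
      have hn₁ := h₁.tables.agents
      have hm₁ := h₁.tables.objects
      have hmiddle := run_forLt_induction orc (v := 23) (b := .copies)
        (p := .forLt 24 .agents Solver.discover) (s := s₁)
        (fun w s' => SearchInv n m J κ lev f a (fun i z b =>
          (i < j ∧ z < m + m ∧ b < n) ∨ (i = j ∧ z < w ∧ b < n)) s')
        (h₁.congr (by omega) (by simp)) (by
          intro w hw₂ s₂ h₂ hw' hk₂
          have hn₂ := h₂.tables.agents
          have hj₂ : s₂ 22 0 = j := by
            rw [hk₂ 22 (by simp) (by simpa [writes] using hw.1), hj₁]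
          have hinner := run_forLt_induction orc (v := 24) (b := .agents)
            (p := Solver.discover) (s := s₂)
            (fun x s' => SearchInv n m J κ lev f a (fun i z b =>
              (i < j ∧ z < m + m ∧ b < n) ∨ (i = j ∧ z < w ∧ b < n) ∨
                (i = j ∧ z = w ∧ b < x)) s')
            (h₂.congr (by omega) (by simp)) (by
              intro x hx s₃ h₃ hx' hk₃
              have hj₃ : s₃ 22 0 = j := by rw [hk₃ 22 (by simp) hw.1, hj₂]
              have hw₃ : s₃ 23 0 = w := by rw [hk₃ 23 (by simp) hw.2, hw']
              rw [Bound.val, hn₂] at hx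
              rw [Bound.val, hm₁] at hw₂
              have := h₃.discover hJ hf (by omega) (by omega) (by omega)
              rw [hj₃, hw₃, hx'] at this
              exact this.congr (by omega) (by simp))
          rw [Bound.val, hn₂] at hinner
          exact hinner.congr (by omega) (by simp))
      rw [Bound.val, hm₁] at hmiddle
      exact hmiddle.congr (by omega) (by simp))
  rwa [Bound.val, hn] at houter

/-! ### Augmentation by repeated scans of the queue -/

theorem run_take (hJ : IsDouble orc m J) {s : Mem} (hs : HasTables n m κ s)
    (hf : IsAssignment J n κ lev (s 7)) (hz : s 23 0 < m + m)
    (hj : s 22 0 < s 15 0 → s 9 (s 22 0) < n) :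
    ((s 22 0 < s 15 0 ∧ CanTake J n κ (s 8) (s 7) (s 9 (s 22 0)) (s 23 0)) ∧
      take.run orc s 7 = Function.update (s 7) (s 9 (s 22 0)) (s 23 0 + 1) ∧
      take.run orc s 15 0 = s 22 0) ∨
    (¬ (s 22 0 < s 15 0 ∧ CanTake J n κ (s 8) (s 7) (s 9 (s 22 0)) (s 23 0)) ∧
      take.run orc s 7 = s 7 ∧ take.run orc s 15 0 = s 15 0) := by
  have h1 : (Expr.sub (.var 15) (.var 22)).eval s ≠ 0 ↔ s 22 0 < s 15 0 := by
    simp only [Expr.eval]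
    omega
  rw [take, run_branch]
  by_cases hlt : s 22 0 < s 15 0
  swap
  · rw [if_neg (by rwa [h1])]
    exact Or.inr ⟨fun h => hlt h.1, rfl, rfl⟩
  rw [if_pos (h1.2 hlt), run_branch]
  have h2 := hs.eval_offLevel (hj hlt) hz
  by_cases hlev : κ (s 9 (s 22 0)) (s 23 0) = s 8 (s 9 (s 22 0))
  swap
  · rw [if_pos (h2.2 hlev)]
    exact Or.inr ⟨fun h => hlev h.2.1, rfl, rfl⟩
  rw [if_neg (by rw [h2, not_not]; exact hlev), run_seq, run_seq, run_branch, run_assign]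
  -- Testing with the dummy agent `n` excludes nobody, so the test refers to all assigned elements.
  generalize hs₀ : s.write 24 _ _ = s₀
  have hframe₀ : ∀ k, k ≠ 24 → s₀ k = s k := fun k hk => by
    rw [← hs₀, Mem.write_apply_of_ne _ _ _ hk]
  have h24 : s₀ 24 0 = n := by
    rw [← hs₀, Mem.write_apply_self]
    simp [Expr.eval, hs.agents]
  have htest := run_test (orc := orc) (n := n) (s := s₀) (κ := κ) (lev := lev) hJ
    (by rw [hframe₀ 0 (by simp), hs.agents]) (by rw [hframe₀ 0 (by simp), hs.objects])
    (by rwa [hframe₀ 7 (by simp)]) (by rwa [hframe₀ 23 (by simp)])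
  rw [h24, hframe₀ 7 (by simp), hframe₀ 23 (by simp)] at htest
  have hframe : ∀ k, k ∉ [30, 11, 12, 13, 14, 24] → test.run orc s₀ k = s k := fun k hk => by
    rw [run_apply_of_notMem _ _ _ (by simp [test, clear, mark, copyHalf, writes] at hk ⊢; tauto),
      hframe₀ k (by simp at hk; tauto)]
  generalize test.run orc s₀ = s' at htest hframe
  have h5 : (Expr.var 13).eval s' = s' 13 0 := rfl
  by_cases hav : Avail J (s 7) n (s 23 0)
  · rw [if_pos (by rw [h5]; exact htest.2 hav)]
    refine Or.inl ⟨⟨hlt, hlev, hav⟩, ?_⟩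
    simp only [run_seq, run_assign, Expr.eval, Mem.write_apply_self,
      Mem.write_apply_of_ne _ _ _ (show 7 ≠ 15 by simp),
      Mem.write_apply_of_ne _ _ _ (show 22 ≠ 7 by simp), hframe 7 (by simp), hframe 9 (by simp),
      hframe 22 (by simp), hframe 23 (by simp), Function.update_self, and_self]
  · rw [if_neg (by rw [h5]; exact fun h => hav (htest.1 h)), run_skip]
    exact Or.inr ⟨fun h => hav h.2.2, hframe 7 (by simp), by rw [hframe 15 (by simp)]⟩

/-- The invariant of a scan of the queue; `D` is the set of pairs of an index and an element that
have been treated. -/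
structure ScanInv (n m : ℕ) (J : Matroid ℕ) (κ : ℕ → ℕ → ℕ) (lev f st : ℕ → ℕ) (ℓ : ℕ)
    (D : ℕ → ℕ → Prop) (s : Mem) : Prop where
  tables : HasTables n m κ s
  levels : s 8 = lev
  queue : s 9 = st
  state : (s 7 = f ∧ s 15 0 = ℓ ∧ ∀ i w, D i w → i < ℓ → ¬ CanTake J n κ lev f (st i) w) ∨
    ∃ i w, D i w ∧ i < ℓ ∧ CanTake J n κ lev f (st i) w ∧
      (∀ i' < i, ∀ w, ¬ CanTake J n κ lev f (st i') w) ∧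
      s 7 = Function.update f (st i) (w + 1) ∧ s 15 0 = i

theorem ScanInv.congr {st : ℕ → ℕ} {ℓ : ℕ} {D D' : ℕ → ℕ → Prop} {s : Mem} {k i v : ℕ}
    (h : ScanInv n m J κ lev f st ℓ D s) (hD : ∀ i z, D' i z ↔ D i z)
    (hk : k ∉ [0, 5, 6, 7, 8, 9, 15]) :
    ScanInv n m J κ lev f st ℓ D' (s.write k i v) := by
  have hw : ∀ k' ∈ [0, 5, 6, 7, 8, 9, 15], s.write k i v k' = s k' := fun k' hk' =>
    Mem.write_apply_of_ne _ _ _ (by rintro rfl; exact hk hk')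
  obtain rfl : D' = D := by
    funext i z
    exact propext (hD i z)
  refine ⟨h.tables.congr (hw 0 (by simp)) (hw 5 (by simp)) (hw 6 (by simp)), ?_, ?_, ?_⟩
  · rw [hw 8 (by simp), h.levels]
  · rw [hw 9 (by simp), h.queue]
  · rw [hw 7 (by simp), hw 15 (by simp)]
    exact h.state

/-- Taking an element cuts the queue at the current index, which disables the rest of the scan;
there is at most one exchange per scan. All smaller indices have been treated completely, so the
agent that takes is the first that can. -/
theorem ScanInv.take (hJ : IsDouble orc m J) {st : ℕ → ℕ} {ℓ : ℕ} {D : ℕ → ℕ → Prop} {s : Mem}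
    (h : ScanInv n m J κ lev f st ℓ D s) (hf : IsAssignment J n κ lev f)
    (hst : ∀ i < ℓ, st i < n) (hD : ∀ i z, D i z → i ≤ s 22 0)
    (hD' : ∀ i < s 22 0, ∀ z < m + m, D i z) (hz : s 23 0 < m + m) :
    ScanInv n m J κ lev f st ℓ (fun i z => D i z ∨ i = s 22 0 ∧ z = s 23 0) (take.run orc s) := by
  have hframe : ∀ k, k ∉ [30, 11, 12, 13, 14, 24, 7, 15] → Solver.take.run orc s k = s k :=
    fun k hk => run_apply_of_notMem _ _ _
      (by simp [Solver.take, test, clear, mark, copyHalf, writes] at hk ⊢; tauto)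
  -- An implication, because `s 7` is either `f` or its update, and validity is checked separately
  -- in the two cases.
  have key : IsAssignment J n κ lev (s 7) → _ := fun hf' =>
    run_take hJ h.tables hf' hz (fun hlt => by
      rw [h.queue]
      refine hst _ ?_
      rcases h.state with ⟨-, e, -⟩ | ⟨i, -, -, hi, -, -, -, e⟩ <;> omega)
  rw [h.levels, h.queue] at key
  generalize Solver.take.run orc s = s' at hframe key
  refine ⟨h.tables.congr (hframe 0 (by simp)) (hframe 5 (by simp)) (hframe 6 (by simp)),
    by rw [hframe 8 (by simp), h.levels], by rw [hframe 9 (by simp), h.queue], ?_⟩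
  rcases h.state with ⟨e7, e15, hno⟩ | ⟨i, w, hiw, hi, hcan, hmin, e7, e15⟩
  · rw [e7, e15] at key
    rcases key hf with ⟨⟨hlt, hcan⟩, e7', e15'⟩ | ⟨hcan, e7', e15'⟩
    · refine Or.inr ⟨s 22 0, s 23 0, Or.inr ⟨rfl, rfl⟩, hlt, hcan, fun i hi w hw => ?_, e7', e15'⟩
      exact hno i w (hD' i hi w ((hJ.ground w).1 hw.2.1)) (by omega) hw
    · refine Or.inl ⟨e7', e15', ?_⟩
      rintro i w (hD'' | ⟨rfl, rfl⟩) hi hc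
      · exact hno i w hD'' hi hc
      · exact hcan ⟨hi, hc⟩
  · have hle := hD i w hiw
    rw [e7, e15] at key
    rcases key (hf.update (hst i hi) hcan) with ⟨⟨hlt, -⟩, -⟩ | ⟨-, e7', e15'⟩
    · omega
    · exact Or.inr ⟨i, w, Or.inl hiw, hi, hcan, hmin, e7', e15'⟩

theorem ScanInv.scan (hJ : IsDouble orc m J) {st : ℕ → ℕ} {ℓ : ℕ} {s : Mem}
    (h : ScanInv n m J κ lev f st ℓ (fun _ _ => False) s) (hf : IsAssignment J n κ lev f)
    (hst : ∀ i < ℓ, st i < n) :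
    ScanInv n m J κ lev f st ℓ (fun i z => i < n ∧ z < m + m) (scan.run orc s) := by
  have hw : 22 ∉ Solver.take.writes ∧ 23 ∉ Solver.take.writes := by
    simp [Solver.take, test, clear, mark, copyHalf, writes]
  have hn := h.tables.agents
  have houter := run_forLt_induction orc (v := 22) (b := .agents)
    (p := .forLt 23 .copies Solver.take) (s := s)
    (fun j s' => ScanInv n m J κ lev f st ℓ (fun i z => i < j ∧ z < m + m) s')
    (h.congr (by simp) (by simp)) (by
      intro j hj s₁ h₁ hj₁ _
      have hn₁ := h₁.tables.agents
      have hm₁ := h₁.tables.objects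
      have hinner := run_forLt_induction orc (v := 23) (b := .copies)
        (p := Solver.take) (s := s₁)
        (fun w s' => ScanInv n m J κ lev f st ℓ (fun i z =>
          (i < j ∧ z < m + m) ∨ (i = j ∧ z < w)) s')
        (h₁.congr (by omega) (by simp)) (by
          intro w hw₂ s₂ h₂ hw' hk₂
          have hj₂ : s₂ 22 0 = j := by rw [hk₂ 22 (by simp) hw.1, hj₁]
          rw [Bound.val, hm₁] at hw₂
          have := h₂.take hJ hf hst (by omega) (by omega) (by omega)
          rw [hj₂, hw'] at this
          exact this.congr (by omega) (by simp))
      rw [Bound.val, hm₁] at hinner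
      exact hinner.congr (by omega) (by simp))
  rwa [Bound.val, hn] at houter

/-- The invariant of the repeated scans of the queue after `r` rounds. -/
structure RepeatInv (n m : ℕ) (J : Matroid ℕ) (κ : ℕ → ℕ → ℕ) (lev f st : ℕ → ℕ) (a ℓ r : ℕ)
    (s : Mem) : Prop where
  tables : HasTables n m κ s
  levels : s 8 = lev
  queue : s 9 = st
  assignment : IsAssignment J n κ lev (s 7)
  ne_zero_iff : ∀ c ≠ a, s 7 c ≠ 0 ↔ f c ≠ 0
  state : (s 7 = f ∧ s 15 0 = ℓ ∧ ∀ i < ℓ, ∀ w, ¬ CanTake J n κ lev f (st i) w) ∨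
    (s 15 0 = 0 ∧ s 7 a ≠ 0) ∨
    (IsChain J n κ lev (s 7) a st (s 15 0) ∧ s 15 0 + r ≤ n ∧
      ∃ i < s 15 0, ∃ w, CanTake J n κ lev (s 7) (st i) w)

theorem RepeatInv.congr {st : ℕ → ℕ} {a ℓ r : ℕ} {s : Mem} {k i v : ℕ}
    (h : RepeatInv n m J κ lev f st a ℓ r s) (hk : k ∉ [0, 5, 6, 7, 8, 9, 15]) :
    RepeatInv n m J κ lev f st a ℓ r (s.write k i v) := by
  have hw : ∀ k' ∈ [0, 5, 6, 7, 8, 9, 15], s.write k i v k' = s k' := fun k' hk' =>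
    Mem.write_apply_of_ne _ _ _ (by rintro rfl; exact hk hk')
  refine ⟨h.tables.congr (hw 0 (by simp)) (hw 5 (by simp)) (hw 6 (by simp)), ?_, ?_, ?_, ?_, ?_⟩
  · rw [hw 8 (by simp), h.levels]
  · rw [hw 9 (by simp), h.queue]
  · rw [hw 7 (by simp)]
    exact h.assignment
  · rw [hw 7 (by simp)]
    exact h.ne_zero_iff
  · rw [hw 7 (by simp), hw 15 (by simp)]
    exact h.state

/-- While the chain contains an agent that can take an element, a scan either serves `a`, at
position `0`, or shortens the chain by `IsChain.shorten`. The bound on length plus rounds limits the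
number of scans needed. -/
theorem RepeatInv.scan (hJ : IsDouble orc m J) {st : ℕ → ℕ} {a ℓ r : ℕ} {s : Mem}
    (h : RepeatInv n m J κ lev f st a ℓ r s) (hst : ∀ i < ℓ, st i < n) (hℓ : ℓ ≤ n) :
    RepeatInv n m J κ lev f st a ℓ (r + 1) (scan.run orc s) := by
  have hlen : (∀ i < s 15 0, st i < n) ∧ s 15 0 ≤ n := by
    rcases h.state with ⟨-, e, -⟩ | ⟨e, -⟩ | ⟨hc, hr, -⟩
    · rw [e]
      exact ⟨hst, hℓ⟩
    · rw [e]
      exact ⟨by simp, by simp⟩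
    · exact ⟨hc.lt, by omega⟩
  have hscan := ScanInv.scan (orc := orc) (f := s 7) (ℓ := s 15 0) hJ
    ⟨h.tables, h.levels, h.queue, Or.inl ⟨rfl, rfl, by simp⟩⟩ h.assignment hlen.1
  generalize Solver.scan.run orc s = s' at hscan
  have hst' := h.state
  rcases hscan.state with ⟨e7, e15, hno⟩ | ⟨i, w, -, hi, hcan, hmin, e7, e15⟩
  · have hno' : ∀ i < s 15 0, ∀ w, ¬ CanTake J n κ lev (s 7) (st i) w := fun i hi w hc =>
      hno i w ⟨by omega, (hJ.ground w).1 hc.2.1⟩ hi hc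
    refine ⟨hscan.tables, hscan.levels, hscan.queue, by rw [e7]; exact h.assignment,
      by rw [e7]; exact h.ne_zero_iff, ?_⟩
    rw [e7, e15]
    rcases hst' with h' | h' | ⟨-, -, i, hi, w, hc⟩
    · exact Or.inl h'
    · exact Or.inr (Or.inl h')
    · exact absurd hc (hno' i hi w)
  · rcases hst' with ⟨e7', e15', hno⟩ | ⟨e, -⟩ | ⟨hc, hr, -⟩
    · rw [e7'] at hcan
      exact absurd hcan (hno i (by omega) w)
    · omega
    refine ⟨hscan.tables, hscan.levels, hscan.queue,
      by rw [e7]; exact h.assignment.update (hlen.1 i hi) hcan, ?_, ?_⟩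
    · intro c hca
      rw [← h.ne_zero_iff c hca, e7, Function.update_apply]
      split_ifs with hci
      · subst hci
        simp only [ne_eq, Nat.add_eq_zero_iff, one_ne_zero, and_false, not_false_eq_true, true_iff]
        refine hc.ne_zero i hi (Nat.pos_of_ne_zero ?_)
        rintro rfl
        exact hca hc.first
      · rfl
    · right
      rw [e7, e15]
      rcases Nat.eq_zero_or_pos i with rfl | hi0
      · left
        rw [hc.first, Function.update_self]
        exact ⟨rfl, by omega⟩
      · right
        obtain ⟨h1, h2⟩ := hc.shorten h.assignment hi hcan hmin hi0
        exact ⟨h1, by omega, h2⟩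

/-- If nobody in the finished queue can take an element, the queue is closed under links and
`IsAssignment.blocks` applies to it; otherwise the scans end by serving the new agent. Apart from
that agent the queue contains only holders of elements, so an exchange never changes who else is
assigned. -/
theorem run_augment (hJ : IsDouble orc m J) {s : Mem} (hs : HasTables n m κ s) (ha : s 20 0 < n)
    (hf : IsAssignment J n κ (s 8) (s 7)) (ha0 : s 7 (s 20 0) = 0) :
    IsAssignment J n κ (s 8) (augment.run orc s 7) ∧
    (∀ c ≠ s 20 0, augment.run orc s 7 c ≠ 0 ↔ s 7 c ≠ 0) ∧
    (augment.run orc s 7 (s 20 0) ≠ 0 ∨ augment.run orc s 7 (s 20 0) = 0 ∧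
      ∀ z ∈ J.E, κ (s 20 0) z = s 8 (s 20 0) →
        ∃ D ⊆ {b | s 7 b ≠ 0}, Blocks J κ (s 8) D z) := by
  set a := s 20 0 with hadef
  have hclear := run_forLt_induction orc (v := 24) (b := .agents)
    (p := .assign 10 (.var 24) (.const 0)) (s := s)
    (fun i s' => ∀ c < i, s' 10 c = 0) (by simp) (by
      intro i _ s' hs' hv _ q hq
      simp only [run_assign, Expr.eval, Mem.write_apply_of_ne _ _ _ (show 10 ≠ 24 by simp),
        Mem.write_apply_self, hv, Function.update_apply]
      split_ifs with hqi
      · rfl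
      · exact hs' q (by omega))
  rw [Bound.val, hs.agents] at hclear
  have hframe₁ : ∀ k, k ∉ [10, 24] →
      (Code.forLt 24 .agents (.assign 10 (.var 24) (.const 0))).run orc s k = s k := fun k hk =>
    run_apply_of_notMem _ _ _ (by simp [writes] at hk ⊢; tauto)
  rw [augment, run_seq, run_seq, run_seq, run_seq, run_seq, run_assign, run_assign, run_assign]
  generalize (Code.forLt 24 .agents (.assign 10 (.var 24) (.const 0))).run orc s = s₁ at *
  simp only [Expr.eval, Mem.write_apply_of_ne _ _ _ (show 20 ≠ 10 by simp), hframe₁ 20 (by simp),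
    ← hadef]
  generalize hs₂ : Mem.write (Mem.write (s₁.write 10 a 1) 9 0 a) 15 0 1 = s₂
  have hframe₂ : ∀ k, k ∉ [10, 24, 9, 15] → s₂ k = s k := fun k hk => by
    simp only [List.mem_cons, List.not_mem_nil, or_false, not_or] at hk
    rw [← hs₂, Mem.write_apply_of_ne _ _ _ hk.2.2.2, Mem.write_apply_of_ne _ _ _ hk.2.2.1,
      Mem.write_apply_of_ne _ _ _ hk.1, hframe₁ k (by simp; tauto)]
  have h15 : s₂ 15 0 = 1 := by rw [← hs₂, Mem.write_apply_self, Function.update_self]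
  have h9 : s₂ 9 0 = a := by
    rw [← hs₂, Mem.write_apply_of_ne _ _ _ (by simp), Mem.write_apply_self, Function.update_self]
  have h10 : ∀ c < n, s₂ 10 c ≠ 0 ↔ c = a := fun c hc => by
    rw [← hs₂, Mem.write_apply_of_ne _ _ _ (by simp), Mem.write_apply_of_ne _ _ _ (by simp),
      Mem.write_apply_self, Function.update_apply]
    split_ifs with hca
    · simp [hca]
    · simp [hca, hclear c hc]
  have hinit : SearchInv n m J κ (s 8) (s 7) a (fun _ _ _ => False) s₂ := by
    refine ⟨hs.congr (hframe₂ 0 (by simp)) (hframe₂ 5 (by simp)) (hframe₂ 6 (by simp)),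
      hframe₂ 7 (by simp), hframe₂ 8 (by simp), ⟨ha0, h9, ?_, ?_, ?_, ?_⟩, by omega, ?_, by simp⟩
    · intro i hi
      obtain rfl : i = 0 := by omega
      rwa [h9]
    all_goals try (intros; omega)
    intro c hc
    rw [h10 c hc, h15]
    constructor
    · rintro rfl
      exact ⟨0, by simp, h9⟩
    · rintro ⟨i, hi, e⟩
      obtain rfl : i = 0 := by omega
      rw [← e, h9]
  have hsearch := hinit.search (orc := orc) hJ hf
  clear hs₂ hframe₂ h15 h9 h10 hinit hclear hframe₁
  generalize search.run orc s₂ = s₃ at hsearch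
  have hle := hsearch.chain.length_le
  have h₀ : RepeatInv n m J κ (s 8) (s 7) (s₃ 9) a (s₃ 15 0) 0 s₃ := by
    refine ⟨hsearch.tables, hsearch.levels, rfl, by rw [hsearch.assigned]; exact hf,
      by rw [hsearch.assigned]; simp, ?_⟩
    by_cases hno : ∀ i < s₃ 15 0, ∀ w, ¬ CanTake J n κ (s 8) (s 7) (s₃ 9 i) w
    · exact Or.inl ⟨hsearch.assigned, rfl, hno⟩
    · push Not at hno
      rw [hsearch.assigned]
      exact Or.inr (Or.inr ⟨hsearch.chain, by omega, hno⟩)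
  have hrep := run_forLt_induction orc (v := 25) (b := .agents) (p := scan) (s := s₃)
    (fun r s' => RepeatInv n m J κ (s 8) (s 7) (s₃ 9) a (s₃ 15 0) r s') (h₀.congr (by simp))
    (fun r _ s' hs' _ _ => (hs'.scan hJ hsearch.chain.lt hle).congr (by simp))
  rw [Bound.val, hsearch.tables.agents] at hrep
  generalize (Code.forLt 25 .agents scan).run orc s₃ = s₄ at hrep
  refine ⟨hrep.assignment, hrep.ne_zero_iff, ?_⟩
  rcases hrep.state with ⟨e7, -, hno⟩ | ⟨-, h⟩ | ⟨-, hr, i, hi, -⟩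
  · right
    rw [e7]
    refine ⟨ha0, fun z hz hza => ?_⟩
    refine ⟨{c | ∃ i < s₃ 15 0, s₃ 9 i = c} \ {a}, ?_, ?_⟩
    · rintro c ⟨⟨i, hi, rfl⟩, hca⟩
      refine hsearch.chain.ne_zero i hi (Nat.pos_of_ne_zero ?_)
      rintro rfl
      exact hca hsearch.chain.first
    · refine hf.blocks (R := {c | ∃ i < s₃ 15 0, s₃ 9 i = c}) ha0
        ⟨0, hsearch.pos, hsearch.chain.first⟩ ?_ ?_ hz hza
      · rintro c ⟨i, hi, rfl⟩ hca
        refine hsearch.chain.ne_zero i hi (Nat.pos_of_ne_zero ?_)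
        rintro rfl
        exact hca hsearch.chain.first
      · rintro c ⟨i, hi, rfl⟩ w hw hκ
        refine ⟨fun hav => hno i hi w ⟨hκ, hav⟩, fun b hb hav => ?_⟩
        refine hsearch.done i w b ⟨by omega, (hJ.ground w).1 hw, ?_⟩ hi hκ hb hav
        by_contra hbn
        exact hb (hf.supp b (by omega))
  · exact Or.inl h
  -- After `n` scans the chain would have length zero, yet it has a member that can take an element.
  · omega

/-! ### Serving the agents greedily -/

/-- No element of level at most `r` that is better than its present one can be given to the agent
`c` without making one of the previous agents worse off. -/
def Certified (J : Matroid ℕ) (κ : ℕ → ℕ → ℕ) (lev f : ℕ → ℕ) (c r : ℕ) : Prop :=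
  ∀ z ∈ J.E, 1 ≤ κ c z → κ c z ≤ r → (f c = 0 ∨ κ c z < lev c) →
    ∃ D : Set ℕ, (∀ b ∈ D, b < c ∧ f b ≠ 0) ∧ Blocks J κ lev D z

/-- The invariant while agent `a` is served, after all levels up to `r` have been tried. -/
structure ServeInv (n m : ℕ) (J : Matroid ℕ) (κ : ℕ → ℕ → ℕ) (a r : ℕ) (s : Mem) : Prop where
  tables : HasTables n m κ s
  assignment : IsAssignment J n κ (s 8) (s 7)
  unserved : ∀ c, a < c → s 7 c = 0
  level_le : s 7 a ≠ 0 → s 8 a ≤ r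
  level_pos : ∀ c, s 7 c ≠ 0 → 1 ≤ s 8 c
  previous : ∀ c < a, Certified J κ (s 8) (s 7) c m
  current : Certified J κ (s 8) (s 7) a r

theorem ServeInv.congr {a r : ℕ} {s : Mem} {k i v : ℕ} (h : ServeInv n m J κ a r s)
    (hk : k ∉ [0, 5, 6, 7, 8]) : ServeInv n m J κ a r (s.write k i v) := by
  have hw : ∀ k' ∈ [0, 5, 6, 7, 8], s.write k i v k' = s k' := fun k' hk' =>
    Mem.write_apply_of_ne _ _ _ (by rintro rfl; exact hk hk')
  refine ⟨h.tables.congr (hw 0 (by simp)) (hw 5 (by simp)) (hw 6 (by simp)), ?_, ?_, ?_, ?_, ?_, ?_⟩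
  all_goals rw [hw 7 (by simp)]
  · rw [hw 8 (by simp)]
    exact h.assignment
  · exact h.unserved
  all_goals rw [hw 8 (by simp)]
  · exact h.level_le
  · exact h.level_pos
  · exact h.previous
  · exact h.current

/-- Existing certificates involve only agents before `a`. Setting the level of `a` and moving others
within their levels changes neither the levels of these agents nor the fact that they are assigned.
-/
theorem ServeInv.step (hJ : IsDouble orc m J) {a r : ℕ} {s : Mem} (h : ServeInv n m J κ a r s)
    (ha : s 20 0 = a) (hr : s 21 0 = r) (han : a < n) :
    ServeInv n m J κ a (r + 1)
      ((Code.branch (.read 7 (.var 20)) .skip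
        (.seq (.assign 8 (.var 20) (.add (.var 21) (.const 1))) augment)).run orc s) := by
  rw [run_branch]
  have hcond : (Expr.read 7 (.var 20)).eval s = s 7 a := by simp only [Expr.eval, ha]
  rw [hcond, run_skip]
  split_ifs with h7
  · refine ⟨h.tables, h.assignment, h.unserved, fun h0 => (h.level_le h0).trans (by omega),
      h.level_pos, h.previous, fun z hz h1 _ h2 => h.current z hz h1 ?_ h2⟩
    have := h.level_le h7
    omega
  rw [not_not] at h7
  rw [run_seq, run_assign]
  have hset : (s.write 8 ((Expr.var 20).eval s) ((Expr.add (.var 21) (.const 1)).eval s)) =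
      s.write 8 a (r + 1) := by simp only [Expr.eval, ha, hr]
  rw [hset]
  generalize hs₁ : s.write 8 a (r + 1) = s₁
  have hframe : ∀ k, k ≠ 8 → s₁ k = s k := fun k hk => by
    rw [← hs₁, Mem.write_apply_of_ne _ _ _ hk]
  have h8 : ∀ c, c ≠ a → s₁ 8 c = s 8 c := fun c hc => by
    rw [← hs₁, Mem.write_apply_self, Function.update_of_ne hc]
  have h8a : s₁ 8 a = r + 1 := by rw [← hs₁, Mem.write_apply_self, Function.update_self]
  have ht₁ : HasTables n m κ s₁ :=
    h.tables.congr (hframe 0 (by simp)) (hframe 5 (by simp)) (hframe 6 (by simp))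
  have hf := h.assignment
  have hf₁ : IsAssignment J n κ (s₁ 8) (s₁ 7) := by
    rw [hframe 7 (by simp)]
    refine ⟨hf.supp, hf.inj, hf.indep, fun c z hc => ?_⟩
    rw [h8 c (by rintro rfl; omega)]
    exact hf.level_eq c z hc
  have key := run_augment hJ ht₁ (by rwa [hframe 20 (by simp), ha]) hf₁
    (by rw [hframe 7 (by simp), hframe 20 (by simp), ha, h7])
  rw [hframe 20 (by simp), ha, hframe 7 (by simp)] at key
  have hframe' : ∀ k, k ∉ [30, 11, 12, 13, 14, 24, 7, 15, 9, 10, 22, 23, 25] →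
      augment.run orc s₁ k = s₁ k := fun k hk => run_apply_of_notMem _ _ _ (by
        simp [augment, search, discover, scan, take, test, clear, mark, copyHalf, writes] at hk ⊢
        tauto)
  generalize augment.run orc s₁ = s₂ at key hframe'
  obtain ⟨hf₂, hiff, hres⟩ := key
  have e8 := hframe' 8 (by simp)
  rw [← e8] at hf₂ hres h8a
  simp only [← e8] at h8
  have hcert : ∀ c r', (c ≤ a) → Certified J κ (s 8) (s 7) c r' → ∀ z ∈ J.E, 1 ≤ κ c z → κ c z ≤ r' →
      (s 7 c = 0 ∨ κ c z < s 8 c) →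
      ∃ D : Set ℕ, (∀ b ∈ D, b < c ∧ s₂ 7 b ≠ 0) ∧ Blocks J κ (s₂ 8) D z := by
    intro c r' hc hcert z hz h1 hr' h2
    obtain ⟨D, hD, hbl⟩ := hcert z hz h1 hr' h2
    refine ⟨D, fun b hb => ⟨(hD b hb).1, ?_⟩, hbl.congr fun b hb => h8 b ?_⟩
    · have := hD b hb
      exact (hiff b (by omega)).2 this.2
    · have := hD b hb
      omega
  refine ⟨ht₁.congr (hframe' 0 (by simp)) (hframe' 5 (by simp)) (hframe' 6 (by simp)), hf₂,
    fun c hc => ?_, fun _ => h8a.le, fun c hc => ?_, fun c hc => ?_, ?_⟩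
  · by_contra hc0
    exact (hiff c (by omega)).1 hc0 (h.unserved c hc)
  · by_cases hca : c = a
    · rw [hca, h8a]
      omega
    · rw [h8 c hca]
      exact h.level_pos c ((hiff c hca).1 hc)
  · intro z hz h1 hr' h2
    refine hcert c m hc.le (h.previous c hc) z hz h1 hr' ?_
    rcases h2 with h2 | h2
    · left
      by_contra hc0
      exact (hiff c (by omega)).2 hc0 h2
    · right
      rwa [h8 c (by omega)] at h2
  · intro z hz h1 hr' h2
    -- Levels up to `r` were excluded in earlier rounds; on level `r + 1` a certificate is needed
    -- only if the augmentation failed, and then the stuck search provides it.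
    by_cases hlt : κ a z ≤ r
    · exact hcert a r le_rfl h.current z hz h1 hlt (Or.inl h7)
    · rcases hres with hres | ⟨-, hD⟩
      · rcases h2 with h2 | h2
        · exact absurd h2 hres
        · omega
      · obtain ⟨D, hD, hbl⟩ := hD z hz (by omega)
        refine ⟨D, fun b hb => ?_, hbl⟩
        have hb0 : s 7 b ≠ 0 := hD hb
        have hba : b < a := by
          rcases lt_trichotomy b a with h | rfl | h'
          · exact h
          · exact absurd h7 hb0
          · exact absurd (h.unserved b h') hb0
        exact ⟨hba, (hiff b (by omega)).2 hb0⟩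

theorem run_serve (hJ : IsDouble orc m J) {s : Mem} (hs : HasTables n m κ s)
    (h7 : ∀ c, s 7 c = 0) (hE : J.Indep ∅) :
    IsAssignment J n κ (serve.run orc s 8) (serve.run orc s 7) ∧
      (∀ c, serve.run orc s 7 c ≠ 0 → 1 ≤ serve.run orc s 8 c) ∧
      ∀ c < n, Certified J κ (serve.run orc s 8) (serve.run orc s 7) c m := by
  have hw : 20 ∉ augment.writes ∧ 21 ∉ augment.writes := by
    simp [augment, search, discover, scan, take, test, clear, mark, copyHalf, writes]
  have houter := run_forLt_induction orc (v := 20) (b := .agents)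
    (p := .forLt 21 .objects
      (.branch (.read 7 (.var 20)) .skip
        (.seq (.assign 8 (.var 20) (.add (.var 21) (.const 1))) augment))) (s := s)
    (fun a s' => HasTables n m κ s' ∧ IsAssignment J n κ (s' 8) (s' 7) ∧
      (∀ c, a ≤ c → s' 7 c = 0) ∧ (∀ c, s' 7 c ≠ 0 → 1 ≤ s' 8 c) ∧ ∀ c < a, Certified J κ (s' 8) (s' 7) c m)
    (by
      simp only [Mem.write_apply_of_ne _ _ _ (show 7 ≠ 20 by simp),
        Mem.write_apply_of_ne _ _ _ (show 8 ≠ 20 by simp)]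
      refine ⟨hs.congr (by rw [Mem.write_apply_of_ne _ _ _ (by simp)])
        (by rw [Mem.write_apply_of_ne _ _ _ (by simp)])
        (by rw [Mem.write_apply_of_ne _ _ _ (by simp)]),
        ⟨fun c _ => h7 c, fun c d _ h => absurd (h7 c) h, ?_, fun c z h => ?_⟩,
        fun c _ => h7 c, fun c h => absurd (h7 c) h, by simp⟩
      · convert hE
        ext z
        simp [occ, h7]
      · rw [h7] at h
        omega)
    (by
      rintro a ha s₁ ⟨ht, hf, h0, hpos, hc⟩ ha' -
      rw [Bound.val, hs.agents] at ha
      have hinner := run_forLt_induction orc (v := 21) (b := .objects)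
        (p := .branch (.read 7 (.var 20)) .skip
          (.seq (.assign 8 (.var 20) (.add (.var 21) (.const 1))) augment)) (s := s₁)
        (fun r s' => ServeInv n m J κ a r s')
        (ServeInv.congr ⟨ht, hf, fun c hc => h0 c hc.le, fun h => absurd (h0 a le_rfl) h, hpos, hc,
          fun z _ h1 h2 _ => by omega⟩ (by simp))
        (by
          intro r hr s₂ h₂ hr' hk
          have ha₂ : s₂ 20 0 = a := by
            rw [hk 20 (by simp) (by simpa [writes] using hw.1), ha']
          exact (h₂.step hJ ha₂ hr' ha).congr (by simp))
      rw [Bound.val, ht.objects] at hinner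
      have := ServeInv.congr (k := 20) (i := 0) (v := a + 1) hinner (by simp)
      refine ⟨this.tables, this.assignment, this.unserved, this.level_pos, fun c hc => ?_⟩
      rcases Nat.lt_succ_iff_lt_or_eq.1 hc with hc | rfl
      · exact this.previous c hc
      · exact this.current)
  rw [Bound.val, hs.agents] at houter
  exact ⟨houter.2.1, houter.2.2.2⟩

/-! ### Address arithmetic, rank tables and output -/

theorem mul_add_inj {w a b x y : ℕ} (hx : x < w) (hy : y < w) (h : a * w + x = b * w + y) :
    a = b ∧ x = y := by
  have h1 : (a * w + x) / w = a := by
    rw [Nat.add_comm, Nat.add_mul_div_right _ _ (by omega), Nat.div_eq_of_lt hx, Nat.zero_add]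
  have h2 : (b * w + y) / w = b := by
    rw [Nat.add_comm, Nat.add_mul_div_right _ _ (by omega), Nat.div_eq_of_lt hy, Nat.zero_add]
  have hab : a = b := by rw [← h1, h, h2]
  subst hab
  exact ⟨rfl, by omega⟩

theorem run_tables {s : Mem} (hn : s 0 0 = n) (hm : s 0 1 = m) :
    ∀ c < n, tables.run orc s 18 c = c * m ∧ tables.run orc s 5 c = c * (m + m) := by
  rw [tables, run_seq, run_seq, run_assign, run_assign]
  generalize hs₁ : Mem.write _ 17 _ _ = s₁
  have h0 : s₁ 0 = s 0 := by
    rw [← hs₁, Mem.write_apply_of_ne _ _ _ (by simp), Mem.write_apply_of_ne _ _ _ (by simp)]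
  have h16 : s₁ 16 0 = 0 := by
    rw [← hs₁, Mem.write_apply_of_ne _ _ _ (by simp), Mem.write_apply_self]
    simp [Expr.eval]
  have h17 : s₁ 17 0 = 0 := by
    rw [← hs₁, Mem.write_apply_self]
    simp [Expr.eval]
  have := run_forLt_induction orc (v := 20) (b := .agents)
    (p := .seq (.assign 18 (.var 20) (.var 16)) (.seq (.assign 5 (.var 20) (.var 17))
      (.seq (.set 16 (.add (.var 16) (.read 0 (.const 1))))
      (.set 17 (.add (.var 17) (.add (.read 0 (.const 1)) (.read 0 (.const 1)))))))) (s := s₁)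
    (fun i s' => s' 16 0 = i * m ∧ s' 17 0 = i * (m + m) ∧
      ∀ c < i, s' 18 c = c * m ∧ s' 5 c = c * (m + m))
    (by simpa [Mem.write_apply_of_ne] using ⟨h16, h17⟩) (by
      rintro i _ s' ⟨e16, e17, hs'⟩ hv hk
      have e0 : s' 0 1 = m := by rw [hk 0 (by simp) (by simp [writes]), h0, hm]
      simp only [run_seq, run_assign, Expr.eval, Mem.write_apply_self, ne_eq,
        Nat.reduceEqDiff, not_false_eq_true, Mem.write_apply_of_ne, OfNat.zero_ne_ofNat,
        hv, e16, e17, e0, Function.update_self]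
      refine ⟨by ring, by ring, fun c hc => ?_⟩
      rw [Function.update_apply, Function.update_apply]
      split_ifs with hci
      · rw [hci]
        exact ⟨rfl, rfl⟩
      · exact hs' c (by omega))
  rw [Bound.val, h0, hn] at this
  exact this.2.2

/-- The address of a comparison contains a product, and the machine has no multiplication; the loop
adds `a * m + s 22 0` to the accumulator `m` times. -/
theorem run_compare {s : Mem} (hm : s 0 1 = m) {a : ℕ} (ha : s 20 0 = a) (h18 : s 18 a = a * m) :
    compare.run orc s 17 0 = s 17 0 + s 2 ((a * m + s 22 0) * m + s 21 0) := by
  rw [compare, run_seq, run_seq, run_assign, run_assign]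
  generalize hs₁ : s.write 16 _ _ = s₁
  have hframe₁ : ∀ k, k ≠ 16 → s₁ k = s k := fun k hk => by
    rw [← hs₁, Mem.write_apply_of_ne _ _ _ hk]
  have h16 : s₁ 16 0 = 0 := by
    rw [← hs₁, Mem.write_apply_self]
    simp [Expr.eval]
  have hframe₂ : ∀ k, k ≠ 16 → k ≠ 23 → (Code.forLt 23 .objects
      (.set 16 (.add (.var 16) (.add (.read 18 (.var 20)) (.var 22))))).run orc s₁ k = s k := by
    intro k hk hk'
    rw [run_apply_of_notMem _ _ _ (by simp [writes, hk, hk']), hframe₁ k hk]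
  have := run_forLt_induction orc (v := 23) (b := .objects)
    (p := .set 16 (.add (.var 16) (.add (.read 18 (.var 20)) (.var 22)))) (s := s₁)
    (fun i s' => s' 16 0 = i * (a * m + s 22 0))
    (by simpa [Mem.write_apply_of_ne] using h16) (by
      intro i _ s' hs' hv hk
      rw [Mem.write_apply_of_ne _ _ _ (by simp), run_assign, Mem.write_apply_self]
      simp only [Expr.eval, Function.update_self]
      rw [hs', hk 18 (by simp) (by simp [writes]), hk 20 (by simp) (by simp [writes]),
        hk 22 (by simp) (by simp [writes]), hframe₁ 18 (by simp), hframe₁ 20 (by simp),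
        hframe₁ 22 (by simp), ha, h18]
      ring)
  rw [Bound.val, hframe₁ 0 (by simp), hm] at this
  generalize (Code.forLt 23 .objects
      (.set 16 (.add (.var 16) (.add (.read 18 (.var 20)) (.var 22))))).run orc s₁ = s₂ at *
  rw [Mem.write_apply_self]
  simp only [Expr.eval, Function.update_self]
  rw [hframe₂ 17 (by simp) (by simp), hframe₂ 2 (by simp) (by simp), hframe₂ 21 (by simp) (by simp),
    this, Nat.mul_comm m]

/-- The level of object `o` for agent `a`, read off the adjacency matrix `A` and the comparison
matrix `P`: zero if the object is not adjacent, and else one more than the number of better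
objects. -/
def rankOf (m : ℕ) (A P : ℕ → ℕ) (a o : ℕ) : ℕ :=
  if A (a * m + o) ≠ 0 then (∑ o' ∈ Finset.range m, P ((a * m + o') * m + o)) + 1 else 0

/-- The levels of the two copies of the objects. -/
def copyRank (m : ℕ) (A P : ℕ → ℕ) (a z : ℕ) : ℕ :=
  rankOf m A P a (if z < m then z else z - m)

theorem run_ranks {s : Mem} (hn : s 0 0 = n) (hm : s 0 1 = m)
    (h18 : ∀ c < n, s 18 c = c * m ∧ s 5 c = c * (m + m)) :
    HasTables n m (copyRank m (s 1) (s 2)) (ranks.run orc s) := by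
  have houter := run_forLt_induction orc (v := 20) (b := .agents)
    (p := .forLt 21 .objects
    (.seq (.set 17 (.const 0))
    (.seq (.forLt 22 .objects compare)
    (.seq (.branch (.read 1 (.add (.read 18 (.var 20)) (.var 21)))
      (.set 17 (.add (.var 17) (.const 1))) (.set 17 (.const 0)))
    (.seq (.assign 6 (.add (.read 5 (.var 20)) (.var 21)) (.var 17))
    (.assign 6 (.add (.read 5 (.var 20)) (.add (.read 0 (.const 1)) (.var 21))) (.var 17)))))))
    (s := s)
    (fun a s' => ∀ c < a, ∀ o < m, s' 6 (c * (m + m) + o) = rankOf m (s 1) (s 2) c o ∧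
      s' 6 (c * (m + m) + (m + o)) = rankOf m (s 1) (s 2) c o) (by simp) (by
      intro a ha s₁ hs₁ hv₁ hk₁
      rw [Bound.val, hn] at ha
      have hm₁ : s₁ 0 1 = m := by rw [hk₁ 0 (by simp) (by simp [compare, writes]), hm]
      have hinner := run_forLt_induction orc (v := 21) (b := .objects)
        (p := .seq (.set 17 (.const 0))
          (.seq (.forLt 22 .objects compare)
          (.seq (.branch (.read 1 (.add (.read 18 (.var 20)) (.var 21)))
            (.set 17 (.add (.var 17) (.const 1))) (.set 17 (.const 0)))
          (.seq (.assign 6 (.add (.read 5 (.var 20)) (.var 21)) (.var 17))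
          (.assign 6 (.add (.read 5 (.var 20)) (.add (.read 0 (.const 1)) (.var 21)))
            (.var 17))))))
        (s := s₁)
        (fun i s' => ∀ c o, o < m → (c < a ∨ c = a ∧ o < i) →
          s' 6 (c * (m + m) + o) = rankOf m (s 1) (s 2) c o ∧
          s' 6 (c * (m + m) + (m + o)) = rankOf m (s 1) (s 2) c o)
        (by
          intro c o ho hc
          rw [Mem.write_apply_of_ne _ _ _ (by simp)]
          exact hs₁ c (by omega) o ho)
        (by
          intro i hi s₂ hs₂ hv₂ hk₂
          rw [Bound.val, hm₁] at hi
          have hframe₂ : ∀ k ∈ [0, 1, 2, 5, 18], s₂ k = s k := by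
            intro k hk
            rw [hk₂ k (by rintro rfl; simp at hk)
              (by simp [compare, writes] at hk ⊢; omega),
              hk₁ k (by rintro rfl; simp at hk) (by simp [compare, writes] at hk ⊢; omega)]
          have hv₂' : s₂ 20 0 = a := by
            rw [hk₂ 20 (by simp) (by simp [compare, writes]), hv₁]
          rw [run_seq, run_seq, run_seq, run_assign, run_branch]
          generalize hs₃ : s₂.write 17 _ _ = s₃
          have hframe₃ : ∀ k, k ≠ 17 → s₃ k = s₂ k := fun k hk => by
            rw [← hs₃, Mem.write_apply_of_ne _ _ _ hk]
          have h17 : s₃ 17 0 = 0 := by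
            rw [← hs₃, Mem.write_apply_self]
            simp [Expr.eval]
          have hcount := run_forLt_induction orc (v := 22) (b := .objects) (p := compare) (s := s₃)
            (fun j s' => s' 17 0 = ∑ o' ∈ Finset.range j, s 2 ((a * m + o') * m + i))
            (by simpa [Mem.write_apply_of_ne] using h17)
            (by
              intro j _ s' hs' hv hk
              have hfr : ∀ k, k ≠ 17 → k ≠ 22 → k ∉ compare.writes → s' k = s₂ k :=
                fun k h h' h'' => by rw [hk k h' h'', hframe₃ k h]
              rw [Mem.write_apply_of_ne _ _ _ (by simp), run_compare (m := m) (a := a), hs',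
                Finset.sum_range_succ, hv,
                hfr 21 (by simp) (by simp) (by simp [compare, writes]), hv₂,
                hfr 2 (by simp) (by simp) (by simp [compare, writes]), hframe₂ 2 (by simp)]
              · rw [hfr 0 (by simp) (by simp) (by simp [compare, writes]), hframe₂ 0 (by simp), hm]
              · rw [hfr 20 (by simp) (by simp) (by simp [compare, writes]), hv₂']
              · rw [hfr 18 (by simp) (by simp) (by simp [compare, writes]), hframe₂ 18 (by simp)]
                exact (h18 a ha).1)
          rw [Bound.val, hframe₃ 0 (by simp), hframe₂ 0 (by simp), hm] at hcount
          have hframe₄ : ∀ k, k ∉ [16, 17, 22, 23] →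
              (Code.forLt 22 .objects compare).run orc s₃ k = s₂ k := fun k hk => by
            rw [run_apply_of_notMem _ _ _ (by simp [compare, writes] at hk ⊢; tauto),
              hframe₃ k (by simp at hk; tauto)]
          generalize (Code.forLt 22 .objects compare).run orc s₃ = s₄ at hcount hframe₄
          have hcond : (Expr.read 1 (.add (.read 18 (.var 20)) (.var 21))).eval s₄ =
              s 1 (a * m + i) := by
            simp only [Expr.eval]
            rw [hframe₄ 1 (by simp), hframe₄ 18 (by simp), hframe₄ 20 (by simp),
              hframe₄ 21 (by simp), hframe₂ 1 (by simp), hframe₂ 18 (by simp), hv₂', hv₂,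
              (h18 a ha).1]
          rw [hcond]
          generalize hs₅ : (if s 1 (a * m + i) ≠ 0 then _ else _) = s₅
          have h₅ : s₅ 17 0 = rankOf m (s 1) (s 2) a i := by
            rw [← hs₅, rankOf]
            split_ifs
            · rw [run_assign, Mem.write_apply_self]
              simp [Expr.eval, hcount]
            · rw [run_assign, Mem.write_apply_self]
              simp [Expr.eval]
          have hframe₅ : ∀ k, k ∉ [16, 17, 22, 23] → s₅ k = s₂ k := fun k hk => by
            have hk' : k ≠ 17 := by simp at hk; tauto
            rw [← hs₅]
            split_ifs
            · rw [run_assign, Mem.write_apply_of_ne _ _ _ hk', hframe₄ k hk]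
            · rw [run_assign, Mem.write_apply_of_ne _ _ _ hk', hframe₄ k hk]
          rw [Mem.write_apply_of_ne _ _ _ (by simp), run_seq, run_assign, run_assign]
          simp only [Mem.write_apply_self, Expr.eval,
            Mem.write_apply_of_ne _ _ _ (show 17 ≠ 6 by simp),
            Mem.write_apply_of_ne _ _ _ (show 5 ≠ 6 by simp),
            Mem.write_apply_of_ne _ _ _ (show 20 ≠ 6 by simp),
            Mem.write_apply_of_ne _ _ _ (show 21 ≠ 6 by simp),
            Mem.write_apply_of_ne _ _ _ (show 0 ≠ 6 by simp), h₅, hframe₅ 5 (by simp),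
            hframe₅ 20 (by simp), hframe₅ 21 (by simp), hframe₅ 0 (by simp), hframe₅ 6 (by simp),
            hv₂, hv₂', hframe₂ 5 (by simp), hframe₂ 0 (by simp), hm, (h18 a ha).2]
          intro c o ho hc
          by_cases hca : c = a ∧ o = i
          · obtain ⟨rfl, rfl⟩ := hca
            constructor
            · rw [Function.update_of_ne (by omega), Function.update_self]
            · rw [Function.update_self]
          · have hold := hs₂ c o ho (by omega)
            have h1 : ∀ x y, x < m + m → y < m + m → (x = y → o = i) →
                c * (m + m) + x ≠ a * (m + m) + y := fun x y hx hy hxy e => by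
              obtain ⟨rfl, e'⟩ := mul_add_inj hx hy e
              exact hca ⟨rfl, hxy e'⟩
            rw [Function.update_of_ne (h1 o (m + i) (by omega) (by omega) (by omega)),
              Function.update_of_ne (h1 o i (by omega) (by omega) (by omega)),
              Function.update_of_ne (h1 (m + o) (m + i) (by omega) (by omega) (by omega)),
              Function.update_of_ne (h1 (m + o) i (by omega) (by omega) (by omega))]
            exact hold)
      rw [Bound.val, hm₁] at hinner
      intro c hc o ho
      rw [Mem.write_apply_of_ne _ _ _ (by simp)]
      exact hinner c o ho (by omega))
  rw [Bound.val, hn] at houter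
  have hframe : ∀ k, k ∉ [20, 21, 17, 22, 16, 23, 6] → ranks.run orc s k = s k := fun k hk =>
    run_apply_of_notMem _ _ _ (by simp [ranks, compare, writes] at hk ⊢; tauto)
  refine ⟨?_, ?_, fun c hc z hz => ?_⟩
  · rw [hframe 0 (by simp), hn]
  · rw [hframe 0 (by simp), hm]
  · rw [hframe 5 (by simp), (h18 c hc).2, copyRank]
    split_ifs with hzm
    · exact (houter c hc z hzm).1
    · have := (houter c hc (z - m) (by omega)).2
      rwa [Nat.add_sub_cancel' (by omega)] at this

/-- With truncated subtraction, `1 - ne x y` is an equality test. -/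
theorem run_output {s : Mem} (hn : s 0 0 = n) (hm : s 0 1 = m) (h18 : ∀ c < n, s 18 c = c * m) :
    ∀ c < n, ∀ o < m, (output.run orc s 3 (c * m + o) ≠ 0 ↔ s 7 c = o + 1) ∧
      (output.run orc s 4 (c * m + o) ≠ 0 ↔ s 7 c = m + o + 1) := by
  have houter := run_forLt_induction orc (v := 20) (b := .agents)
    (p := .forLt 21 .objects
    (.seq (.assign 3 (.add (.read 18 (.var 20)) (.var 21))
      (.sub (.const 1) (ne (.read 7 (.var 20)) (.add (.var 21) (.const 1)))))
    (.assign 4 (.add (.read 18 (.var 20)) (.var 21))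
      (.sub (.const 1) (ne (.read 7 (.var 20))
        (.add (.add (.read 0 (.const 1)) (.var 21)) (.const 1)))))))
    (s := s)
    (fun a s' => ∀ c < a, ∀ o < m, (s' 3 (c * m + o) ≠ 0 ↔ s 7 c = o + 1) ∧
      (s' 4 (c * m + o) ≠ 0 ↔ s 7 c = m + o + 1)) (by simp) (by
      intro a ha s₁ hs₁ hv₁ hk₁
      rw [Bound.val, hn] at ha
      have hm₁ : s₁ 0 1 = m := by rw [hk₁ 0 (by simp) (by simp [writes]), hm]
      have hinner := run_forLt_induction orc (v := 21) (b := .objects)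
        (p := .seq (.assign 3 (.add (.read 18 (.var 20)) (.var 21))
            (.sub (.const 1) (ne (.read 7 (.var 20)) (.add (.var 21) (.const 1)))))
          (.assign 4 (.add (.read 18 (.var 20)) (.var 21))
            (.sub (.const 1) (ne (.read 7 (.var 20))
              (.add (.add (.read 0 (.const 1)) (.var 21)) (.const 1))))))
        (s := s₁)
        (fun i s' => ∀ c o, o < m → (c < a ∨ c = a ∧ o < i) →
          (s' 3 (c * m + o) ≠ 0 ↔ s 7 c = o + 1) ∧ (s' 4 (c * m + o) ≠ 0 ↔ s 7 c = m + o + 1))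
        (by
          intro c o ho hc
          rw [Mem.write_apply_of_ne _ _ _ (by simp), Mem.write_apply_of_ne _ _ _ (by simp)]
          exact hs₁ c (by omega) o ho)
        (by
          intro i hi s₂ hs₂ hv₂ hk₂
          rw [Bound.val, hm₁] at hi
          have hframe₂ : ∀ k ∈ [0, 7, 18], s₂ k = s k := by
            intro k hk
            rw [hk₂ k (by rintro rfl; simp at hk) (by simp [writes] at hk ⊢; omega),
              hk₁ k (by rintro rfl; simp at hk) (by simp [writes] at hk ⊢; omega)]
          have hv₂' : s₂ 20 0 = a := by rw [hk₂ 20 (by simp) (by simp [writes]), hv₁]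
          intro c o ho hc
          rw [run_seq, run_assign, run_assign]
          simp only [Mem.write_apply_self, Expr.eval, ne,
            Mem.write_apply_of_ne _ _ _ (show 3 ≠ 21 by simp),
            Mem.write_apply_of_ne _ _ _ (show 4 ≠ 21 by simp),
            Mem.write_apply_of_ne _ _ _ (show 3 ≠ 4 by simp),
            Mem.write_apply_of_ne _ _ _ (show 4 ≠ 3 by simp),
            Mem.write_apply_of_ne _ _ _ (show 18 ≠ 3 by simp),
            Mem.write_apply_of_ne _ _ _ (show 7 ≠ 3 by simp),
            Mem.write_apply_of_ne _ _ _ (show 20 ≠ 3 by simp),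
            Mem.write_apply_of_ne _ _ _ (show 21 ≠ 3 by simp),
            Mem.write_apply_of_ne _ _ _ (show 0 ≠ 3 by simp),
            hv₂, hv₂', hframe₂ 0 (by simp), hframe₂ 7 (by simp), hframe₂ 18 (by simp), hm, h18 a ha]
          by_cases hca : c = a ∧ o = i
          · obtain ⟨rfl, rfl⟩ := hca
            rw [Function.update_self, Function.update_self]
            omega
          · have h1 : c * m + o ≠ a * m + i := fun e => hca (mul_add_inj ho hi e)
            rw [Function.update_of_ne h1, Function.update_of_ne h1]
            exact hs₂ c o ho (by omega))
      rw [Bound.val, hm₁] at hinner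
      intro c hc o ho
      rw [Mem.write_apply_of_ne _ _ _ (by simp), Mem.write_apply_of_ne _ _ _ (by simp)]
      exact hinner c o ho (by omega))
  rwa [Bound.val, hn] at houter

theorem run_main (hJ : IsDouble orc m J) {s : Mem} (hn : s 0 0 = n) (hm : s 0 1 = m)
    (h7 : ∀ c, s 7 c = 0) (hE : J.Indep ∅) :
    ∃ lev f, IsAssignment J n (copyRank m (s 1) (s 2)) lev f ∧
      (∀ c, f c ≠ 0 → 1 ≤ lev c) ∧
      (∀ c < n, Certified J (copyRank m (s 1) (s 2)) lev f c m) ∧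
      ∀ c < n, ∀ o < m, (main.run orc s 3 (c * m + o) ≠ 0 ↔ f c = o + 1) ∧
        (main.run orc s 4 (c * m + o) ≠ 0 ↔ f c = m + o + 1) := by
  rw [main, run_seq, run_seq, run_seq]
  have h₁ := run_tables (orc := orc) hn hm
  have hframe₁ : ∀ k, k ∉ [16, 17, 20, 18, 5] → tables.run orc s k = s k := fun k hk =>
    run_apply_of_notMem _ _ _ (by simp [tables, writes] at hk ⊢; tauto)
  generalize tables.run orc s = s₁ at h₁ hframe₁
  have h₂ := run_ranks (orc := orc) (n := n) (m := m) (s := s₁) (by rw [hframe₁ 0 (by simp), hn])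
    (by rw [hframe₁ 0 (by simp), hm]) h₁
  rw [hframe₁ 1 (by simp), hframe₁ 2 (by simp)] at h₂
  have hframe₂ : ∀ k, k ∉ [20, 21, 17, 22, 16, 23, 6] → ranks.run orc s₁ k = s₁ k := fun k hk =>
    run_apply_of_notMem _ _ _ (by simp [ranks, compare, writes] at hk ⊢; tauto)
  generalize ranks.run orc s₁ = s₂ at h₂ hframe₂
  obtain ⟨h₃, h₃', h₃''⟩ := run_serve hJ h₂
    (by rw [hframe₂ 7 (by simp), hframe₁ 7 (by simp)]; exact h7) hE
  have hframe₃ : ∀ k ∈ [0, 18], serve.run orc s₂ k = s₂ k := fun k hk =>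
    run_apply_of_notMem _ _ _ (by
      simp [serve, augment, search, discover, scan, take, test, clear, mark, copyHalf,
        writes] at hk ⊢
      omega)
  generalize serve.run orc s₂ = s₃ at h₃ h₃' h₃'' hframe₃
  refine ⟨s₃ 8, s₃ 7, h₃, h₃', h₃'', run_output ?_ ?_ ?_⟩
  · rw [hframe₃ 0 (by simp), h₂.agents]
  · rw [hframe₃ 0 (by simp), h₂.objects]
  · rw [hframe₃ 18 (by simp), hframe₂ 18 (by simp)]
    exact fun c hc => (h₁ c hc).1

end Solver

/-! ## Certified assignments are popular and Pareto-optimal -/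

open Solver (Certified)

variable {A O : Type*} {n m : ℕ}

/-- The two copies of an object. -/
def copy (eO : O ≃ Fin m) : Bool → O → ℕ
  | false, o => eO o
  | true, o => m + eO o

theorem copy_lt (eO : O ≃ Fin m) (i : Bool) (o : O) : copy eO i o < m + m := by
  have := (eO o).2
  cases i <;> simp only [copy] <;> omega

theorem copy_inj (eO : O ≃ Fin m) {i j : Bool} {o o' : O} (h : copy eO i o = copy eO j o') :
    i = j ∧ o = o' := by
  have h1 := (eO o).2
  have h2 := (eO o').2
  cases i <;> cases j <;> simp only [copy] at h
  · exact ⟨rfl, eO.injective (Fin.ext h)⟩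
  · omega
  · omega
  · exact ⟨rfl, eO.injective (Fin.ext (by omega))⟩

theorem exists_copy (eO : O ≃ Fin m) {z : ℕ} (hz : z < m + m) : ∃ i o, copy eO i o = z := by
  by_cases h : z < m
  · exact ⟨false, eO.symm ⟨z, h⟩, by simp [copy]⟩
  · exact ⟨true, eO.symm ⟨z - m, by omega⟩, by simp [copy]; omega⟩

/-- Under the numberings `eA` and `eO`, the matroid `J` consists of two copies of the matroid of the
instance, and `κ` describes its graph and preferences. -/
structure Encodes (I : MatchingInstance A O) (eA : A ≃ Fin n) (eO : O ≃ Fin m) (J : Matroid ℕ)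
    (κ : ℕ → ℕ → ℕ) : Prop where
  ground : ∀ z, z ∈ J.E ↔ z < m + m
  indep : ∀ X, J.Indep X ↔ X ⊆ J.E ∧ ∀ i, I.matroid.Indep {o | copy eO i o ∈ X}
  adj_iff : ∀ a i o, 1 ≤ κ (eA a) (copy eO i o) ↔ I.Adj a o
  pref_iff : ∀ a i o j o', I.Adj a o → I.Adj a o' →
    (I.pref a o o' ↔ κ (eA a) (copy eO i o) < κ (eA a) (copy eO j o'))
  le : ∀ a i o, κ (eA a) (copy eO i o) ≤ m

/-- A certified assignment. -/
structure IsSolution (J : Matroid ℕ) (n m : ℕ) (κ : ℕ → ℕ → ℕ) (lev f : ℕ → ℕ) : Prop extends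
    IsAssignment J n κ lev f where
  lev_pos : ∀ c, f c ≠ 0 → 1 ≤ lev c
  certified : ∀ c < n, Certified J κ lev f c m

variable {I : MatchingInstance A O} {eA : A ≃ Fin n} {eO : O ≃ Fin m} {J : Matroid ℕ}
  {κ : ℕ → ℕ → ℕ} {lev f : ℕ → ℕ} {M : Bool → Finset (A × O)}

theorem Encodes.copy_mem_ground (hI : Encodes I eA eO J κ) (i : Bool) (o : O) :
    copy eO i o ∈ J.E := (hI.ground _).2 (copy_lt eO i o)

/-- By irreflexivity no object is better than itself, so neither copy can have the smaller level;
both levels are zero if the object is not adjacent. -/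
theorem Encodes.level_copy (hI : Encodes I eA eO J κ) (hw : I.WeakRankings) (a : A) (i j : Bool)
    (o : O) : κ (eA a) (copy eO i o) = κ (eA a) (copy eO j o) := by
  by_cases h : I.Adj a o
  · have h0 := (hw a).irrefl o h
    rw [hI.pref_iff a i o j o h h] at h0
    have h1 := (hw a).irrefl o h
    rw [hI.pref_iff a j o i o h h] at h1
    omega
  · have h1 := mt (hI.adj_iff a i o).1 h
    have h2 := mt (hI.adj_iff a j o).1 h
    omega

theorem certified_copy (hI : Encodes I eA eO J κ) (hf : IsSolution J n m κ lev f) {a : A} {o : O} (hadj : I.Adj a o) {i : Bool}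
    (h : f (eA a) = 0 ∨ κ (eA a) (copy eO i o) < lev (eA a)) :
    ∃ D : Set ℕ, (∀ b ∈ D, b < eA a ∧ f b ≠ 0) ∧ Blocks J κ lev D (copy eO i o) :=
  hf.certified _ (eA a).2 _ (hI.copy_mem_ground i o) ((hI.adj_iff a i o).2 hadj) (hI.le a i o) h

section Solution

variable (hI : Encodes I eA eO J κ) (hf : IsSolution J n m κ lev f)
  (hM : ∀ i a o, (a, o) ∈ M i ↔ f (eA a) = copy eO i o + 1)
include hI hf hM

/-- Independence in the double restricts to each copy, and injectivity of `f` keeps the objects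
within a copy distinct. -/
theorem mem_constrainedMatchings (i : Bool) : M i ∈ I.constrainedMatchings := by
  refine ⟨⟨?_, ?_, ?_⟩, ?_⟩
  · rintro ⟨a, o⟩ h
    rw [hM] at h
    rw [← hI.adj_iff a i o, hf.level_eq _ _ h]
    exact hf.lev_pos _ (by omega)
  · rintro ⟨a, o⟩ h ⟨a', o'⟩ h' (rfl : a = a')
    rw [hM] at h h'
    rw [(copy_inj eO (show copy eO i o = copy eO i o' by omega)).2]
  · rintro ⟨a, o⟩ h ⟨a', o'⟩ h' (rfl : o = o')
    rw [hM] at h h'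
    have := hf.inj _ _ (h.trans h'.symm) (by omega)
    rw [eA.injective (Fin.ext this)]
  · refine (((hI.indep _).1 hf.indep).2 i).subset ?_
    rintro o ⟨a, h⟩
    rw [hM] at h
    exact ⟨eA a, trivial, h⟩

theorem exists_mem_of_ne_zero {a : A} (ha : f (eA a) ≠ 0) :
    ∃ i o, (a, o) ∈ M i ∧ I.Adj a o ∧ κ (eA a) (copy eO i o) = lev (eA a) := by
  have hz : f (eA a) = (f (eA a) - 1) + 1 := by omega
  have hE : f (eA a) - 1 ∈ J.E := hf.indep.subset_ground ⟨_, trivial, hz⟩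
  obtain ⟨i, o, h⟩ := exists_copy eO ((hI.ground _).1 hE)
  rw [← h] at hz
  have hl := hf.level_eq _ _ hz
  refine ⟨i, o, (hM i a o).2 hz, (hI.adj_iff a i o).1 ?_, hl⟩
  rw [hl]
  exact hf.lev_pos _ ha

/-- An agent prefers a matching to both matchings of a solution if and only if it gets a better
object. -/
theorem prefers_iff {Z : Finset (A × O)} (hZ : Z ∈ I.constrainedMatchings) (a : A) :
    (∀ Y ∈ ({M false, M true} : Set (Finset (A × O))), I.prefMatching a Z Y) ↔
      ∃ o, (a, o) ∈ Z ∧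
        (f (eA a) = 0 ∨ ∀ i, κ (eA a) (copy eO i o) < lev (eA a)) := by
  constructor
  · intro h
    have h' : ∀ i, I.prefMatching a Z (M i) := by
      intro i
      cases i <;> exact h _ (by simp)
    -- An assigned agent holds one copy of one object, so it is matched in just one of the two
    -- matchings, and only the comparison with that one carries information.
    by_cases h0 : f (eA a) = 0
    · obtain ⟨o, ho, -⟩ := h' true
      exact ⟨o, ho, Or.inl h0⟩
    · obtain ⟨i, o', ho', hadj', hl⟩ := exists_mem_of_ne_zero hI hf hM h0
      obtain ⟨o, ho, hpref⟩ := h' i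
      refine ⟨o, ho, Or.inr fun j => ?_⟩
      rw [← hl, ← hI.pref_iff a j o i o' (hZ.1.1 _ ho) hadj']
      exact hpref o' ho'
  · rintro ⟨o, ho, h⟩ Y hY
    obtain ⟨i, rfl⟩ : ∃ i, Y = M i := by
      rcases hY with rfl | rfl
      · exact ⟨false, rfl⟩
      · exact ⟨true, rfl⟩
    refine ⟨o, ho, fun o' ho' => ?_⟩
    have hadj' := (mem_constrainedMatchings hI hf hM i).1.1 _ ho'
    rw [hM] at ho'
    rw [hI.pref_iff a i o i o' (hZ.1.1 _ ho) hadj', hf.level_eq _ _ ho']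
    exact (h.resolve_left (by omega)) i

/-- If an agent prefers no matching of a solution to `Z`, then it gets an object in `Z` that is at
least as good. -/
theorem exists_mem_of_not_prefers {Z : Finset (A × O)} (hZ : Z ∈ I.constrainedMatchings) {a : A}
    (ha : f (eA a) ≠ 0)
    (h : ∀ Y ∈ ({M false, M true} : Set (Finset (A × O))), ¬ I.prefMatching a Y Z) :
    ∃ o, (a, o) ∈ Z ∧ ∀ i, κ (eA a) (copy eO i o) ≤ lev (eA a) := by
  obtain ⟨i, o', ho', hadj', hl⟩ := exists_mem_of_ne_zero hI hf hM ha
  have h' : ¬ I.prefMatching a (M i) Z := h _ (by cases i <;> simp)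
  simp only [MatchingInstance.prefMatching, not_exists, not_and, not_forall] at h'
  obtain ⟨o, ho, hpref⟩ := h' o' ho'
  refine ⟨o, ho, fun j => ?_⟩
  rw [hI.pref_iff a i o' j o hadj' (hZ.1.1 _ ho), hl] at hpref
  omega

/-- A count at the first agent in service order that improves: nobody in its certificate improves or
loses, so these agents and the improving one would need one independent element more than the rank
allows. -/
theorem paretoOptimal_of_isSolution (hw : I.WeakRankings) : I.ParetoOptimal {M false, M true} := by
  refine ⟨?_, ?_⟩
  · rintro Y (rfl | rfl) <;> exact mem_constrainedMatchings hI hf hM _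
  rintro 𝒴 h𝒴 ⟨hcard, hweak, a₁, ha₁⟩
  have : Finite A := Finite.of_equiv _ eA.symm
  have : Finite O := Finite.of_equiv _ eO.symm
  -- Indexing by `Bool` places the members of the dominating set on the two copies of the matroid; a
  -- single member is placed on both.
  obtain ⟨Y, hY, hYi⟩ : ∃ Y : Bool → Finset (A × O), (∀ X ∈ 𝒴, ∃ i, Y i = X) ∧ ∀ i, Y i ∈ 𝒴 := by
    have h2 : 𝒴.ncard ≤ 2 := hcard.trans ((Set.ncard_insert_le _ _).trans (by simp))
    have hfin : 𝒴.Finite := Set.toFinite _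
    obtain ⟨X₀, hX₀, -⟩ := ha₁
    have h0 : 𝒴.ncard ≠ 0 := Set.ncard_ne_zero_of_mem hX₀
    rcases (by omega : 𝒴.ncard = 1 ∨ 𝒴.ncard = 2) with h | h
    · obtain ⟨X, rfl⟩ := Set.ncard_eq_one.1 h
      exact ⟨fun _ => X, by simp, by simp⟩
    · obtain ⟨X, X', -, rfl⟩ := Set.ncard_eq_two.1 h
      refine ⟨fun i => if i then X else X', ?_, ?_⟩
      · rintro Z (rfl | rfl)
        · exact ⟨true, rfl⟩
        · exact ⟨false, rfl⟩
      · intro i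
        cases i <;> simp
  have hYc : ∀ i, Y i ∈ I.constrainedMatchings := fun i => h𝒴 (hYi i)
  -- the first agent that gets a better object
  have himp : ∃ c, ∃ a i o, c = (eA a : ℕ) ∧ (a, o) ∈ Y i ∧
      (f (eA a) = 0 ∨ ∀ j, κ (eA a) (copy eO j o) < lev (eA a)) := by
    obtain ⟨X, hX, h⟩ := ha₁
    obtain ⟨i, rfl⟩ := hY X hX
    obtain ⟨o, ho, h⟩ := (prefers_iff hI hf hM (hYc i) a₁).1 h
    exact ⟨_, a₁, i, o, rfl, ho, h⟩
  classical
  obtain ⟨a, i₀, o₀, hc, ho₀, hbetter⟩ := Nat.find_spec himp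
  have hmin : ∀ b : A, eA b < eA a → ∀ i o, (b, o) ∈ Y i →
      ¬ (f (eA b) = 0 ∨ ∀ j, κ (eA b) (copy eO j o) < lev (eA b)) := fun b hb i o ho h =>
    Nat.find_min himp (m := eA b) (by rw [hc]; exact hb) ⟨b, i, o, rfl, ho, h⟩
  obtain ⟨D, hD, hrk, hcl⟩ := certified_copy hI hf (hYc i₀ |>.1.1 _ ho₀) (i := i₀)
    (hbetter.imp_right fun h => h i₀)
  have htied : ∀ b : A, (eA b : ℕ) ∈ D →
      ∃ i o, (b, o) ∈ Y i ∧ κ (eA b) (copy eO i o) = lev (eA b) := by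
    intro b hb
    obtain ⟨hba, hb0⟩ := hD _ hb
    obtain ⟨X, hX, h⟩ := hweak b
    obtain ⟨i, rfl⟩ := hY X hX
    obtain ⟨o, ho, hle⟩ := exists_mem_of_not_prefers hI hf hM (hYc i) hb0 h
    refine ⟨i, o, ho, le_antisymm (hle i) (not_lt.1 fun hlt => hmin b hba i o ho (Or.inr ?_))⟩
    intro j
    rwa [hI.level_copy hw b j i]
  -- Outside `D` the default is the improving object of `a`. This is the value wanted for `a`
  -- itself, which is not in `D`.
  have hchoice : ∀ b : A, ∃ i o, ((eA b : ℕ) ∈ D ∨ b = a) → (b, o) ∈ Y i ∧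
      copy eO i o ∈ J.closure (levelSet J κ lev D) := by
    intro b
    by_cases hb : (eA b : ℕ) ∈ D
    · obtain ⟨i, o, ho, hl⟩ := htied b hb
      exact ⟨i, o, fun _ => ⟨ho, J.mem_closure_of_mem' ⟨hI.copy_mem_ground i o, _, hb, hl⟩
        (hI.copy_mem_ground i o)⟩⟩
    · refine ⟨i₀, o₀, fun h => ?_⟩
      obtain rfl := h.resolve_left hb
      exact ⟨ho₀, hcl⟩
  choose i o hio using hchoice
  set S : Set A := {b | (eA b : ℕ) ∈ D ∨ b = a} with hS
  set X : Set ℕ := (fun b => copy eO (i b) (o b)) '' S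
  -- On copy `j` the set `X` consists of objects matched in `Y j`.
  have hX : J.Indep X := by
    rw [hI.indep]
    constructor
    · rintro _ ⟨b, -, rfl⟩
      exact hI.copy_mem_ground _ _
    · intro j
      refine (hYc j).2.subset ?_
      rintro p ⟨b, hb, e⟩
      obtain ⟨rfl, rfl⟩ := copy_inj eO e
      exact ⟨b, (hio b hb).1⟩
  have hXcard : X.encard = S.encard := by
    refine Set.InjOn.encard_image ?_
    intro b hb b' hb' e
    obtain ⟨e1, e2⟩ := copy_inj eO e
    have h1 := (hio b hb).1
    have h2 := (hio b' hb').1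
    rw [← e1, ← e2] at h2
    exact congrArg Prod.fst ((hYc _).1.2.2 _ h1 _ h2 rfl)
  have hle : X.encard ≤ D.encard := by
    rw [← hX.eRk_eq_encard]
    refine le_trans (J.eRk_mono ?_) ((J.eRk_closure_eq _).le.trans hrk)
    rintro _ ⟨b, hb, rfl⟩
    exact (hio b hb).2
  have hSD : (fun b : A => (eA b : ℕ)) '' S = insert (eA a : ℕ) D := by
    ext c
    constructor
    · rintro ⟨b, hb | rfl, rfl⟩
      · exact Or.inr hb
      · exact Or.inl rfl
    · rintro (rfl | hc)
      · exact ⟨a, Or.inr rfl, rfl⟩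
      · have hlt : c < n := (hD c hc).1.trans (eA a).2
        exact ⟨eA.symm ⟨c, hlt⟩, Or.inl (by simpa using hc), by simp⟩
  have hinj : Function.Injective (fun b : A => (eA b : ℕ)) := Fin.val_injective.comp eA.injective
  rw [hXcard, ← hinj.encard_image, hSD, Set.encard_insert_of_notMem
    (fun h => lt_irrefl _ (hD _ h).1)] at hle
  have hDfin : D.encard ≠ ⊤ := by
    rw [Set.encard_ne_top_iff]
    exact (Set.finite_lt_nat n).subset fun c hc => (hD c hc).1.trans (eA a).2
  exact absurd hle (not_le.2 (ENat.lt_add_one_iff hDfin |>.2 le_rfl))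

/-- A double count over the tight sets: each object of `Z` that is wanted there uses up two units of
rank, one per copy, whereas each agent of a solution holds only one element. -/
theorem popular_of_isSolution (hw : I.WeakRankings) : I.Popular {M false, M true} := by
  refine ⟨?_, fun Z hZ => ?_⟩
  · rintro Y (rfl | rfl) <;> exact mem_constrainedMatchings hI hf hM _
  have : Finite A := Finite.of_equiv _ eA.symm
  rw [margin, sub_nonneg, Nat.cast_le, phiAlt, phiSet]
  set P := {a : A | ∀ Y ∈ ({M false, M true} : Set (Finset (A × O))), I.prefMatching a Z Y} with hP
  set W := {a : A | ∃ Y ∈ ({M false, M true} : Set (Finset (A × O))), I.prefMatching a Y Z} with hW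
  -- The choice of objects by `choose!` below needs a default object.
  rcases isEmpty_or_nonempty O with hO | hO
  · have : P = ∅ := by
      refine Set.eq_empty_of_forall_notMem fun a ha => ?_
      obtain ⟨o, -⟩ := ha (M true) (by simp)
      exact hO.false o
    rw [this, Set.ncard_empty]
    exact Nat.zero_le _
  set R : Set ℕ := {b | ∃ D : Set ℕ, b ∈ D ∧ (∀ c ∈ D, c < n ∧ f c ≠ 0) ∧
    J.eRk (levelSet J κ lev D) ≤ D.encard} with hR
  have hRlt : ∀ b ∈ R, b < n ∧ f b ≠ 0 := by
    rintro b ⟨D, hb, hD, -⟩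
    exact hD b hb
  have hRcl : ∀ D : Set ℕ, (∀ c ∈ D, c < n ∧ f c ≠ 0) → J.eRk (levelSet J κ lev D) ≤ D.encard →
      levelSet J κ lev D ⊆ J.closure (occ f R) := by
    intro D hD hrk
    have hfin : D.Finite := (Set.finite_lt_nat n).subset fun c hc => (hD c hc).1
    have hocc := hf.encard_occ (fun c hc => (hD c hc).2)
    have hfin' : (occ f D).Finite := by
      rw [← Set.encard_ne_top_iff, hocc, Set.encard_ne_top_iff]
      exact hfin
    -- The elements held by `D` lie on its levels and have rank `|D|` already, so by tightness they
    -- span these levels.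
    have hcl := (J.isRkFinite_of_finite hfin').closure_eq_closure_of_subset_of_eRk_ge_eRk
      (hf.occ_subset_levelSet D) (by rw [(hf.occ_indep D).eRk_eq_encard, hocc]; exact hrk)
    refine (J.subset_closure _ fun z hz => hz.1).trans ?_
    rw [← hcl]
    exact J.closure_subset_closure (occ_mono fun b hb => ⟨D, hb, hD, hrk⟩)
  -- Tied members of `R` are counted along with `P`, so that the rest of `R` must prefer the
  -- solution to `Z`.
  set T := {a : A | (eA a : ℕ) ∈ R ∧ ∃ o, (a, o) ∈ Z ∧ ∀ i, κ (eA a) (copy eO i o) = lev (eA a)}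
    with hT
  set Q := P ∪ T with hQ
  have hobj : ∀ a ∈ Q, ∃ o, (a, o) ∈ Z ∧ ∀ i, copy eO i o ∈ J.closure (occ f R) := by
    rintro a (ha | ⟨haR, o, ho, hl⟩)
    · obtain ⟨o, ho, h⟩ := (prefers_iff hI hf hM hZ a).1 ha
      refine ⟨o, ho, fun i => ?_⟩
      obtain ⟨D, hD, hrk, hcl⟩ := certified_copy hI hf (hZ.1.1 _ ho) (i := i)
        (h.imp_right fun h => h i)
      have := hRcl D (fun c hc => ⟨(hD c hc).1.trans (eA a).2, (hD c hc).2⟩) hrk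
      exact J.closure_subset_closure_of_subset_closure this hcl
    · refine ⟨o, ho, fun i => ?_⟩
      obtain ⟨D, hb, hD, hrk⟩ := haR
      exact hRcl D hD hrk ⟨hI.copy_mem_ground i o, _, hb, hl i⟩
  choose! o ho hocl using hobj
  -- Both copies of each object: `Z` may be used twice in the double, which yields the factor two.
  set X : Set ℕ := (fun p : A × Bool => copy eO p.2 (o p.1)) '' (Q ×ˢ Set.univ)
  have hX : J.Indep X := by
    rw [hI.indep]
    constructor
    · rintro _ ⟨b, -, rfl⟩
      exact hI.copy_mem_ground _ _
    · intro j
      refine hZ.2.subset ?_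
      rintro p ⟨⟨b, j'⟩, hb, e⟩
      obtain ⟨-, rfl⟩ := copy_inj eO e
      exact ⟨b, ho b hb.1⟩
  have hXcard : X.encard = Q.encard * 2 := by
    have h2 : (Set.univ : Set Bool).encard = 2 := by
      rw [← Set.encard_pair Bool.false_ne_true]
      congr 1
      ext i
      cases i <;> simp
    rw [← h2, ← Set.encard_prod]
    refine Set.InjOn.encard_image ?_
    rintro ⟨b, j⟩ hb ⟨b', j'⟩ hb' e
    obtain ⟨e1, e2⟩ := copy_inj eO e
    have h1 := ho b hb.1
    have h2 := ho b' hb'.1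
    simp only at e1 e2
    rw [← e2] at h2
    have e3 : b = b' := congrArg Prod.fst (hZ.1.2.2 _ h1 _ h2 rfl)
    rw [e1, e3]
  set R' : Set A := {a | (eA a : ℕ) ∈ R} with hR'
  have hRR' : R.encard = R'.encard := by
    have hinj : Function.Injective (fun b : A => (eA b : ℕ)) := Fin.val_injective.comp eA.injective
    rw [← hinj.encard_image]
    congr 1
    ext c
    constructor
    · intro hc
      have := (hRlt c hc).1
      exact ⟨eA.symm ⟨c, this⟩, by simpa [hR'] using hc, by simp⟩
    · rintro ⟨b, hb, rfl⟩
      exact hb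
  have hle : Q.encard * 2 ≤ R'.encard := by
    rw [← hXcard, ← hRR', ← hX.eRk_eq_encard, ← hf.encard_occ (fun c hc => (hRlt c hc).2),
      ← (hf.occ_indep R).eRk_eq_encard]
    refine le_trans (J.eRk_mono ?_) (J.eRk_closure_eq _).le
    rintro _ ⟨⟨b, j⟩, hb, rfl⟩
    exact hocl b hb.1 j
  have hle' : Q.ncard * 2 ≤ R'.ncard := by
    rw [← (Set.toFinite Q).cast_ncard_eq, ← (Set.toFinite R').cast_ncard_eq] at hle
    exact_mod_cast hle
  -- A member of `R` that does not prefer the solution gets in `Z` an object on its level, so it is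
  -- in `T`, or a better one, so it is in `P`.
  have hsub : R' ⊆ Q ∪ W := by
    intro a ha
    by_contra hcon
    simp only [Set.mem_union, not_or] at hcon
    obtain ⟨hQ', hW'⟩ := hcon
    have hW'' : ∀ Y ∈ ({M false, M true} : Set (Finset (A × O))), ¬ I.prefMatching a Y Z :=
      fun Y hY h => hW' ⟨Y, hY, h⟩
    obtain ⟨p, hp, hle⟩ := exists_mem_of_not_prefers hI hf hM hZ (hRlt _ ha).2 hW''
    refine hQ' ?_
    by_cases heq : κ (eA a) (copy eO true p) = lev (eA a)
    · exact Or.inr ⟨ha, p, hp, fun i => by rw [hI.level_copy hw a i true, heq]⟩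
    · refine Or.inl ((prefers_iff hI hf hM hZ a).2 ⟨p, hp, Or.inr fun i => ?_⟩)
      rw [hI.level_copy hw a i true]
      exact lt_of_le_of_ne (hle true) heq
  have h1 := Set.ncard_le_ncard hsub (Set.toFinite _)
  have h2 := Set.ncard_union_le Q W
  have h3 : P.ncard ≤ Q.ncard := Set.ncard_le_ncard Set.subset_union_left (Set.toFinite _)
  -- From `2|Q| ≤ |R'| ≤ |Q| + |W|` follows `|P| ≤ |Q| ≤ |W|`.
  omega

end Solution


/-! ## The matroid and the levels of an instance -/

theorem copy_injOn {O : Type*} {m : ℕ} (eO : O ≃ Fin m) (S : Set (Bool × O)) :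
    Set.InjOn (fun p => copy eO p.1 p.2) S :=
  fun _ _ _ _ h => Prod.ext (copy_inj eO h).1 (copy_inj eO h).2

/-- Two copies of a matroid. -/
def double {O : Type*} {m : ℕ} (N : Matroid O) (eO : O ≃ Fin m) : Matroid ℕ :=
  (Matroid.sum' fun _ : Bool => N).map (fun p => copy eO p.1 p.2) (copy_injOn eO _)

theorem mem_double_ground {O : Type*} {m : ℕ} {N : Matroid O} (hN : N.E = Set.univ)
    (eO : O ≃ Fin m) (z : ℕ) : z ∈ (double N eO).E ↔ z < m + m := by
  rw [double, Matroid.map_ground]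
  constructor
  · rintro ⟨p, -, rfl⟩
    exact copy_lt _ _ _
  · intro hz
    obtain ⟨i, o, rfl⟩ := exists_copy eO hz
    refine ⟨(i, o), ?_, rfl⟩
    simp [hN]

theorem double_indep_iff {O : Type*} {m : ℕ} {N : Matroid O} (hN : N.E = Set.univ)
    (eO : O ≃ Fin m) (X : Set ℕ) :
    (double N eO).Indep X ↔
      X ⊆ (double N eO).E ∧ ∀ i, N.Indep {o | copy eO i o ∈ X} := by
  have key : ∀ Y : Set (Bool × O), (Matroid.sum' fun _ : Bool => N).Indep Y ↔
      ∀ i, N.Indep {o | copy eO i o ∈ (fun p : Bool × O => copy eO p.1 p.2) '' Y} := by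
    intro Y
    rw [Matroid.sum'_indep_iff]
    refine forall_congr' fun i => ?_
    congr! 1
    ext o
    constructor
    · exact fun h => ⟨(i, o), h, rfl⟩
    · rintro ⟨⟨j, p⟩, h, e⟩
      obtain ⟨rfl, rfl⟩ := copy_inj eO e
      exact h
  constructor
  · intro h
    refine ⟨h.subset_ground, ?_⟩
    obtain ⟨Y, hY, rfl⟩ := Matroid.map_indep_iff.1 h
    exact (key Y).1 hY
  · rintro ⟨hX, h⟩
    have hXY : X = (fun p : Bool × O => copy eO p.1 p.2) '' {p | copy eO p.1 p.2 ∈ X} := by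
      ext z
      constructor
      · intro hz
        obtain ⟨i, o, rfl⟩ := exists_copy eO ((mem_double_ground hN eO z).1 (hX hz))
        exact ⟨(i, o), hz, rfl⟩
      · rintro ⟨p, hp, rfl⟩
        exact hp
    refine Matroid.map_indep_iff.2 ⟨_, (key _).2 ?_, hXY⟩
    rwa [← hXY]

/-! ### Correctness of the input encoding -/

variable {n m : ℕ} (I : MatchingInstance (Fin n) (Fin m))

theorem isDouble_double : Solver.IsDouble I.indepOracle m (double I.matroid (Equiv.refl _)) where
  ground := mem_double_ground I.ground_eq _
  indep X := by
    rw [double_indep_iff I.ground_eq, Bool.forall_bool]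
    rfl
  congr X Y h := by
    have : {o : Fin m | (o : ℕ) ∈ X} = {o : Fin m | (o : ℕ) ∈ Y} := by
      ext o
      exact h o o.2
    rw [MatchingInstance.indepOracle, MatchingInstance.indepOracle, this]

theorem encode_adj (a : Fin n) (o : Fin m) : I.encode 1 (a * m + o) ≠ 0 ↔ I.Adj a o := by
  change bit _ ≠ 0 ↔ _
  rw [Solver.bit_ne_zero]
  constructor
  · rintro ⟨a', o', e, h⟩
    obtain ⟨h1, h2⟩ := Solver.mul_add_inj o.2 o'.2 e
    rwa [Fin.ext h1, Fin.ext h2]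
  · exact fun h => ⟨a, o, rfl, h⟩

open Classical in
theorem encode_pref (a : Fin n) (o o' : Fin m) :
    I.encode 2 ((a * m + o) * m + o') =
      if I.Adj a o ∧ I.Adj a o' ∧ I.pref a o o' then 1 else 0 := by
  change bit _ = _
  rw [bit]
  congr 1
  refine propext ⟨?_, fun h => ⟨a, o, o', rfl, h⟩⟩
  rintro ⟨b, p, p', e, h⟩
  obtain ⟨h1, h2⟩ := Solver.mul_add_inj o'.2 p'.2 e
  obtain ⟨h3, h4⟩ := Solver.mul_add_inj o.2 p.2 h1
  rwa [Fin.ext h2, Fin.ext h3, Fin.ext h4]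

open Classical in
theorem rankOf_encode (a : Fin n) (o : Fin m) (h : I.Adj a o) :
    Solver.rankOf m (I.encode 1) (I.encode 2) a o =
      (Finset.univ.filter fun o' => I.Adj a o' ∧ I.pref a o' o).card + 1 := by
  rw [Solver.rankOf, if_pos ((encode_adj I a o).2 h), Finset.sum_range, Finset.card_filter]
  congr 1
  refine Finset.sum_congr rfl fun o' _ => ?_
  rw [encode_pref]
  simp [h]

theorem copyRank_copy (a : Fin n) (i : Bool) (o : Fin m) :
    Solver.copyRank m (I.encode 1) (I.encode 2) a (copy (Equiv.refl _) i o) =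
      Solver.rankOf m (I.encode 1) (I.encode 2) a o := by
  have := o.2
  rw [Solver.copyRank]
  cases i <;> simp [copy]

/-- Under a weak ranking the sets of objects better than a given one are nested, so their
cardinalities reproduce the preferences. -/
theorem encodes_encode (hw : I.WeakRankings) : Encodes I (Equiv.refl _) (Equiv.refl _)
    (double I.matroid (Equiv.refl _)) (Solver.copyRank m (I.encode 1) (I.encode 2)) where
  ground := mem_double_ground I.ground_eq _
  indep := double_indep_iff I.ground_eq _
  adj_iff a i o := by
    rw [Equiv.refl_apply, copyRank_copy]
    by_cases h : I.Adj a o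
    · simp [rankOf_encode I a o h, h]
    · have := mt (encode_adj I a o).1 h
      simp [Solver.rankOf, this, h]
  pref_iff a i o j o' h h' := by
    classical
    rw [Equiv.refl_apply, copyRank_copy, copyRank_copy, rankOf_encode I a o h,
      rankOf_encode I a o' h', Nat.add_lt_add_iff_right]
    obtain ⟨hirr, hasymm, htrans, hind⟩ := hw a
    constructor
    · intro hp
      refine Finset.card_lt_card (Finset.ssubset_iff_of_subset ?_ |>.2 ⟨o, ?_, ?_⟩)
      · intro x
        simp only [Finset.mem_filter, Finset.mem_univ, true_and]
        rintro ⟨hx, hxo⟩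
        exact ⟨hx, htrans x hx o h o' h' hxo hp⟩
      · simp [h, hp]
      · simpa [h] using hirr o h
    -- If `o` is not preferred to `o'`, everything better than `o'` is better than `o`, so the count
    -- for `o` is not smaller. Transitivity of indifference is used when `o` is tied with both `x`
    -- and `o'`.
    · intro hlt
      by_contra hp
      refine absurd (Finset.card_le_card ?_) (not_le.2 hlt)
      intro x
      simp only [Finset.mem_filter, Finset.mem_univ, true_and]
      rintro ⟨hx, hxo⟩
      refine ⟨hx, ?_⟩
      by_contra hxo'
      by_cases h1 : I.pref a o' o
      · exact hxo' (htrans x hx o' h' o h hxo h1)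
      by_cases h2 : I.pref a o x
      · exact hp (htrans o h x hx o' h' h2 hxo)
      · exact (hind x hx o h o' h' ⟨hxo', h2⟩ ⟨hp, h1⟩).1 hxo
  -- The object is not better than itself, which makes room for the added one.
  le a i o := by
    classical
    rw [Equiv.refl_apply, copyRank_copy]
    by_cases h : I.Adj a o
    · rw [rankOf_encode I a o h]
      have : (Finset.univ.filter fun o' => I.Adj a o' ∧ I.pref a o' o) ⊂ Finset.univ := by
        refine (Finset.ssubset_iff_of_subset (Finset.subset_univ _)).2 ⟨o, Finset.mem_univ _, ?_⟩
        simpa [h] using (hw a).irrefl o h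
      simpa using Finset.card_lt_card this
    · have := mt (encode_adj I a o).1 h
      simp [Solver.rankOf, this]

/-- The program computes a certified assignment. -/
theorem exists_isSolution : ∃ lev f,
    IsSolution (double I.matroid (Equiv.refl _)) n m
      (Solver.copyRank m (I.encode 1) (I.encode 2)) lev f ∧
    ∀ (a : Fin n) (o : Fin m),
      (Solver.main.run I.indepOracle I.encode 3 (a * m + o) ≠ 0 ↔ f a = o + 1) ∧
      (Solver.main.run I.indepOracle I.encode 4 (a * m + o) ≠ 0 ↔ f a = m + o + 1) := by
  obtain ⟨lev, f, hf, hpos, hcert, hout⟩ := Solver.run_main (isDouble_double I) (s := I.encode)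
    (n := n) rfl rfl (fun _ => rfl) (Matroid.empty_indep _)
  exact ⟨lev, f, ⟨hf, hpos, hcert⟩, fun a o => hout a a.2 o o.2⟩

/-! ### Transport to arbitrary finite sets of agents and objects -/

/-- The instance with renumbered agents and objects. -/
def MatchingInstance.renumber {A O : Type*} (I : MatchingInstance A O) (eA : A ≃ Fin n)
    (eO : O ≃ Fin m) : MatchingInstance (Fin n) (Fin m) where
  Adj a o := I.Adj (eA.symm a) (eO.symm o)
  pref a o o' := I.pref (eA.symm a) (eO.symm o) (eO.symm o')
  matroid := I.matroid.mapEquiv eO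
  ground_eq := by simp [I.ground_eq]

theorem Encodes.of_renumber {A O : Type*} {I : MatchingInstance A O} {eA : A ≃ Fin n}
    {eO : O ≃ Fin m} {J : Matroid ℕ} {κ : ℕ → ℕ → ℕ}
    (h : Encodes (I.renumber eA eO) (Equiv.refl _) (Equiv.refl _) J κ) : Encodes I eA eO J κ := by
  have hcopy : ∀ i o, copy eO i o = copy (Equiv.refl _) i (eO o) := by
    intro i o
    cases i <;> rfl
  refine ⟨h.ground, fun X => ?_, fun a i o => ?_, fun a i o j o' h1 h2 => ?_, fun a i o => ?_⟩
  · rw [h.indep]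
    refine and_congr_right fun _ => forall_congr' fun i => ?_
    rw [MatchingInstance.renumber, Matroid.mapEquiv_indep_iff]
    congr! 1
    ext o
    simp [hcopy]
  · rw [hcopy, ← Equiv.refl_apply (eA a), h.adj_iff]
    simp [MatchingInstance.renumber]
  · rw [hcopy, hcopy, ← Equiv.refl_apply (eA a), ← h.pref_iff (eA a) i (eO o) j (eO o')]
    · simp [MatchingInstance.renumber]
    · simpa [MatchingInstance.renumber]
    · simpa [MatchingInstance.renumber]
  · rw [hcopy, ← Equiv.refl_apply (eA a)]
    exact h.le _ _ _

theorem WeakRankings.renumber {A O : Type*} {I : MatchingInstance A O} (h : I.WeakRankings)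
    (eA : A ≃ Fin n) (eO : O ≃ Fin m) : (I.renumber eA eO).WeakRankings := fun _ =>
  ⟨fun _ hx => (h _).irrefl _ hx, fun _ hx _ hy => (h _).asymm _ hx _ hy,
    fun _ hx _ hy _ hz => (h _).trans _ hx _ hy _ hz,
    fun _ hx _ hy _ hz => (h _).indiff_trans _ hx _ hy _ hz⟩

end PopularSets

theorem mainTheorem2 :
    -- existence
    (∀ (A : Type*) (O : Type*) [Finite A] [Finite O] (I : PopularSets.MatchingInstance A O),
      I.WeakRankings →
      ∃ M₁ M₂ : Finset (A × O), I.ParetoOptimal {M₁, M₂} ∧ I.Popular {M₁, M₂}) ∧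
    -- computation in polynomial time with an independence oracle; the result is in arrays 3 and 4
    (∃ (P : PopularSets.Prog) (p : Polynomial ℕ),
      ∀ (n m : ℕ) (I : PopularSets.MatchingInstance (Fin n) (Fin m)), I.WeakRankings →
        ∃ (t : ℕ) (s : PopularSets.Mem),
          PopularSets.Exec I.indepOracle P I.encode t s ∧
          t ≤ p.eval (n + m) ∧
          I.ParetoOptimal {PopularSets.decode n m s 3, PopularSets.decode n m s 4} ∧
          I.Popular {PopularSets.decode n m s 3, PopularSets.decode n m s 4}) := by
  constructor
  · intro A O _ _ I hw
    have eA := Finite.equivFin A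
    have eO := Finite.equivFin O
    -- Existence is read off the run of the program on the renumbered instance.
    obtain ⟨lev, f, hf, -⟩ := PopularSets.exists_isSolution (I.renumber eA eO)
    have hI := PopularSets.Encodes.of_renumber
      (PopularSets.encodes_encode _ (PopularSets.WeakRankings.renumber hw eA eO))
    let M : Bool → Finset (A × O) := fun i =>
      (Set.toFinite {e : A × O | f (eA e.1) = PopularSets.copy eO i e.2 + 1}).toFinset
    have hM : ∀ i a o, (a, o) ∈ M i ↔ f (eA a) = PopularSets.copy eO i o + 1 := by
      simp [M]
    exact ⟨M false, M true, PopularSets.paretoOptimal_of_isSolution hI hf hM hw,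
      PopularSets.popular_of_isSolution hI hf hM hw⟩
  · refine ⟨PopularSets.Solver.main.compile, PopularSets.Solver.main.time, fun n m I hw => ?_⟩
    obtain ⟨t, ht, hexec⟩ := PopularSets.Code.exec_compile I.indepOracle _
      PopularSets.Solver.main_wellFormed.1 PopularSets.Solver.main_wellFormed.2 I.encode
    obtain ⟨lev, f, hf, hout⟩ := PopularSets.exists_isSolution I
    have hI := PopularSets.encodes_encode I hw
    let M : Bool → Finset (Fin n × Fin m) := fun i =>
      PopularSets.decode n m (PopularSets.Solver.main.run I.indepOracle I.encode) (if i then 4 else 3)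
    have hM : ∀ i a o, (a, o) ∈ M i ↔
        f (Equiv.refl _ a : Fin n) = PopularSets.copy (Equiv.refl _) i o + 1 := by
      intro i a o
      cases i
      · simpa [M, PopularSets.decode, PopularSets.copy] using (hout a o).1
      · simpa [M, PopularSets.decode, PopularSets.copy] using (hout a o).2
    exact ⟨t, _, hexec, ht, PopularSets.paretoOptimal_of_isSolution hI hf hM hw,
      PopularSets.popular_of_isSolution hI hf hM hw⟩
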